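/- Let $n\ge 2$ and let $B_r\subset\mathbb R^n$ be the open ball of radius $r$ centred at $0$. All functions are real-valued, and $\|u\|_{H^1(D)}^2=\|u\|_{L^2(D)}^2+\|\nabla u\|_{L^2(D)}^2$. Let $S_1$ be the space of all $h\in H^1(B_{1/2})$ with $\Delta h=0$ weakly in $B_{1/2}$, and let $S_2$ be the space of all $u\in H^1(B_1)$ with $\Delta u=0$ weakly in $B_1$ and boundary trace $u|_{\partial B_1}\in H^{1/2}(\partial B_1)$, where $$\|g\|_{H^{1/2}(\partial B_1)}^2=\int_{\partial B_1}|g|^2\,d\sigma+\int_{\partial B_1}\int_{\partial B_1}\frac{|g(x)-g(y)|^2}{|x-y|^{n}}\,d\sigma(x)\,d\sigma(y).$$ Then there exist a constant $c>0$, depending only on $n$, and a sequence $(h_j)_{j\ge 1}\subset S_1$ with $\|h_j\|_{H^1(B_{1/2})}=1$ such that, for every $j\ge 1$ and every $u\in S_2$ with $\|h_j-u\|_{L^2(B_{1/2})}\le (10j)^{-1}$, one has $$\|u|_{\partial B_1}\|_{H^{1/2}(\partial B_1)}\ge c\,e^{cj}.$$ -/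

import Mathlib

open MeasureTheory
open scoped ENNReal ContDiff Topology

namespace Runge

/-- Test functions on the set `D`: smooth, with compact support contained in `D`. -/
def IsTestFunction {n : ℕ} (D : Set (EuclideanSpace ℝ (Fin n)))
    (φ : EuclideanSpace ℝ (Fin n) → ℝ) : Prop :=
  ContDiff ℝ ∞ φ ∧ HasCompactSupport φ ∧ tsupport φ ⊆ D

/-- `u ∈ H¹(D)` with weak gradient `G`: both are square integrable on `D`, and
`∫_D u ∂_v φ = - ∫_D (G · v) φ` for all directions `v` and all test functions `φ`.
Only the values of `u` and `G` on `D` matter. -/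
structure HasWeakGradient {n : ℕ} (D : Set (EuclideanSpace ℝ (Fin n)))
    (u : EuclideanSpace ℝ (Fin n) → ℝ)
    (G : EuclideanSpace ℝ (Fin n) → EuclideanSpace ℝ (Fin n)) : Prop where
  memLp : MemLp u 2 (volume.restrict D)
  memLp_grad : MemLp G 2 (volume.restrict D)
  integral_eq : ∀ φ, IsTestFunction D φ → ∀ v : EuclideanSpace ℝ (Fin n),
    ∫ x in D, u x * fderiv ℝ φ x v = - ∫ x in D, inner ℝ (G x) v * φ x

/-- The norm of `H¹(D)`, `(‖u‖²_{L²(D)} + ‖∇u‖²_{L²(D)})^{1/2}`. The weak gradient on an open set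
is unique almost everywhere, so the infimum is over a single value; it is `∞` if `u ∉ H¹(D)`. -/
noncomputable def h1Norm {n : ℕ} (D : Set (EuclideanSpace ℝ (Fin n)))
    (u : EuclideanSpace ℝ (Fin n) → ℝ) : ℝ≥0∞ :=
  ⨅ (G : EuclideanSpace ℝ (Fin n) → EuclideanSpace ℝ (Fin n)) (_ : HasWeakGradient D u G),
    (eLpNorm u 2 (volume.restrict D) ^ 2 + eLpNorm G 2 (volume.restrict D) ^ 2) ^ (1 / 2 : ℝ)

/-- The space `{u ∈ H¹(D) : Δ u = 0 in D}`, the equation being understood weakly: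
`∫_D ∇u · ∇φ = 0` for all test functions `φ`. -/
def harmonicH1 {n : ℕ} (D : Set (EuclideanSpace ℝ (Fin n))) :
    Set (EuclideanSpace ℝ (Fin n) → ℝ) :=
  {u | ∃ G, HasWeakGradient D u G ∧
    ∀ φ, IsTestFunction D φ → ∫ x in D, inner ℝ (G x) (gradient φ x) = 0}

/-- The surface measure of the unit sphere. -/
noncomputable def sphereMeasure (n : ℕ) :
    Measure (Metric.sphere (0 : EuclideanSpace ℝ (Fin n)) 1) :=
  (volume : Measure (EuclideanSpace ℝ (Fin n))).toSphere

/-- The norm of `H^{1/2}(∂B₁)` of a function on the unit sphere of `ℝⁿ`,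
`(∫ |g|² + ∬ |g(x) - g(y)|² / |x - y|ⁿ)^{1/2}`; it may be infinite.
The exponent is `(n - 1) + 2 · (1/2) = n`, as the sphere has dimension `n - 1`. -/
noncomputable def hHalfNorm {n : ℕ}
    (g : Metric.sphere (0 : EuclideanSpace ℝ (Fin n)) 1 → ℝ) : ℝ≥0∞ :=
  ((∫⁻ x, ‖g x‖ₑ ^ 2 ∂sphereMeasure n) +
    ∫⁻ x, ∫⁻ y, ‖g x - g y‖ₑ ^ 2 / edist x y ^ n ∂sphereMeasure n ∂sphereMeasure n) ^ (1 / 2 : ℝ)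

/-- `g ∈ H^{1/2}(∂B₁)`. -/
def MemHHalf {n : ℕ} (g : Metric.sphere (0 : EuclideanSpace ℝ (Fin n)) 1 → ℝ) : Prop :=
  AEStronglyMeasurable g (sphereMeasure n) ∧ hHalfNorm g < ⊤

/-- `H̃^{1/2}(Γ)` for a subset `Γ` of the unit sphere: the closure in `H^{1/2}(∂B₁)` of those
`f ∈ H^{1/2}(∂B₁)` whose (essential) support is contained in `Γ`, that is, which vanish almost
everywhere outside a closed subset of `Γ`. -/
def hHalfTilde {n : ℕ} (Γ : Set (Metric.sphere (0 : EuclideanSpace ℝ (Fin n)) 1)) :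
    Set (Metric.sphere (0 : EuclideanSpace ℝ (Fin n)) 1 → ℝ) :=
  {g | MemHHalf g ∧ ∀ ε : ℝ≥0∞, 0 < ε → ∃ f, MemHHalf f ∧
    (∃ K ⊆ Γ, IsClosed K ∧ ∀ᵐ x ∂sphereMeasure n, x ∉ K → f x = 0) ∧
    hHalfNorm (fun x => g x - f x) < ε}

/-- `g ∈ L²(∂B₁)` is the boundary trace of `u ∈ H¹(B₁)`: there are functions `φ k`, smooth up to
the boundary, with `φ k → u` in `H¹(B₁)` and `φ k → g` in `L²(∂B₁)`. -/
def IsTrace {n : ℕ} (u : EuclideanSpace ℝ (Fin n) → ℝ)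
    (g : Metric.sphere (0 : EuclideanSpace ℝ (Fin n)) 1 → ℝ) : Prop :=
  MemLp g 2 (sphereMeasure n) ∧
  ∃ φ : ℕ → EuclideanSpace ℝ (Fin n) → ℝ, (∀ k, ContDiff ℝ ∞ (φ k)) ∧
    Filter.Tendsto (fun k => h1Norm (Metric.ball 0 1) (fun x => φ k x - u x))
      Filter.atTop (𝓝 0) ∧
    Filter.Tendsto (fun k => eLpNorm
      (fun x : Metric.sphere (0 : EuclideanSpace ℝ (Fin n)) 1 => φ k x - g x) 2 (sphereMeasure n))
      Filter.atTop (𝓝 0)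

/-- The space `{u ∈ H¹(B₁) : Δ u = 0 in B₁, u|_{∂B₁} ∈ H̃^{1/2}(Γ)}`. -/
def harmonicH1Boundary {n : ℕ} (Γ : Set (Metric.sphere (0 : EuclideanSpace ℝ (Fin n)) 1)) :
    Set (EuclideanSpace ℝ (Fin n) → ℝ) :=
  {u | u ∈ harmonicH1 (Metric.ball 0 1) ∧ ∃ g, IsTrace u g ∧ g ∈ hHalfTilde Γ}

end Runge

/-! The obstruction is a single spherical harmonic. Let `p` be a solid harmonic of degree `k`.
Homogeneity makes its norm in `L²` of the unit sphere at least `2 ^ k` times its norm `a` in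
`L²(B_{1/2})`, while normalizing `p` in `H¹(B_{1/2})` makes `a` decay only like `1 / k`. A harmonic
`u` that is `δ`-close to `p` on the half ball, with `δ < a`, must carry most of the component of `p`
there, and this component grows by the same factor `2 ^ k` on its way to the sphere. Hence the trace
has `L²` norm at least `2 ^ k * (a - δ)` (`IsSolidHarmonic.le_eLpNorm_trace`), and the `H^{1/2}`
norm is larger still.

The transfer from half ball to sphere avoids expansions in spherical harmonics and interior
regularity. Testing with radial multiples of `p` and of its partial derivatives gives the integrated
form of `x · ∇u = k u` against `p` (`IsSolidHarmonic.integral_radial_deriv`). The divergence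
theorem, applied to the smooth approximants in the definition of the trace, then expresses every
radial moment of `u p` through the one number `∫ g p` on the sphere
(`IsSolidHarmonic.integral_trace`). The same formula holds for `p` itself, so a fixed combination of
`u p` and `p²` has vanishing moments against all powers of `‖x‖²`. By Weierstrass approximation its
integral over the half ball vanishes too (`IsSolidHarmonic.integral_half_ball_mul`). Two
applications of Cauchy-Schwarz finish the estimate. -/

namespace Runge

/-! ### Polar coordinates and the divergence theorem on the unit ball -/

section Polar

variable {E : Type*} [NormedAddCommGroup E] [NormedSpace ℝ E] [Nontrivial E]
  [FiniteDimensional ℝ E] [MeasurableSpace E] [BorelSpace E]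

/-- Integration in polar coordinates. -/
theorem integral_eq_integral_toSphere (μ : Measure E) [μ.IsAddHaarMeasure] {F : E → ℝ}
    (hF : Integrable F μ) :
    ∫ x, F x ∂μ = ∫ θ : Metric.sphere (0 : E) 1,
      (∫ r in Set.Ioi (0 : ℝ), r ^ (Module.finrank ℝ E - 1) * F (r • (θ : E))) ∂μ.toSphere := by
  have hemb := (homeomorphUnitSphereProd E).measurableEmbedding
  have hmp := μ.measurePreserving_homeomorphUnitSphereProd
  set H : Metric.sphere (0 : E) 1 × Set.Ioi (0 : ℝ) → ℝ := fun q => F ((q.2 : ℝ) • (q.1 : E))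
    with hH
  have hcomp : ∀ x : ({0}ᶜ : Set E), H (homeomorphUnitSphereProd E x) = F x := by
    intro x
    have : ‖(x : E)‖ ≠ 0 := norm_ne_zero_iff.2 x.2
    simp [hH, smul_smul, this]
  have hint : Integrable H (μ.toSphere.prod (.volumeIoiPow (Module.finrank ℝ E - 1))) := by
    rw [← hmp.integrable_comp_emb hemb]
    have h1 : IntegrableOn F ({0}ᶜ : Set E) μ := hF.integrableOn
    rw [integrableOn_iff_comap_subtypeVal (measurableSet_singleton _).compl] at h1
    refine h1.congr (Filter.Eventually.of_forall fun x => ?_)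
    exact (hcomp x).symm
  calc
    ∫ x, F x ∂μ = ∫ x : ({0}ᶜ : Set E), F x ∂(μ.comap (↑)) := by
      rw [integral_subtype_comap (measurableSet_singleton _).compl fun x ↦ F x,
        restrict_compl_singleton]
    _ = ∫ q, H q ∂μ.toSphere.prod (.volumeIoiPow (Module.finrank ℝ E - 1)) := by
      rw [← hmp.integral_comp hemb]
      simp only [hcomp]
    _ = ∫ θ, ∫ r, H (θ, r) ∂(.volumeIoiPow (Module.finrank ℝ E - 1)) ∂μ.toSphere :=
      integral_prod _ hint
    _ = _ := by
      refine integral_congr_ae (Filter.Eventually.of_forall fun θ => ?_)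
      simp only [Measure.volumeIoiPow, ENNReal.ofReal, hH]
      rw [integral_withDensity_eq_integral_smul,
        integral_subtype_comap measurableSet_Ioi
          fun a ↦ Real.toNNReal (a ^ (Module.finrank ℝ E - 1)) • F (a • (θ : E)),
        setIntegral_congr_fun measurableSet_Ioi fun x hx ↦ ?_]
      · rw [NNReal.smul_def, Real.coe_toNNReal _ (pow_nonneg hx.out.le _), smul_eq_mul]
      · exact (measurable_subtype_coe.pow_const _).real_toNNReal

/-- The divergence theorem on the unit ball for the vector field `x ↦ a x • x`. -/
theorem integral_toSphere_eq_integral_ball (μ : Measure E) [μ.IsAddHaarMeasure] {a : E → ℝ}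
    (ha : ContDiff ℝ 1 a) :
    ∫ θ : Metric.sphere (0 : E) 1, a θ ∂μ.toSphere =
      ∫ x in Metric.ball (0 : E) 1, (Module.finrank ℝ E * a x + fderiv ℝ a x x) ∂μ := by
  set d := Module.finrank ℝ E with hd
  have hdpos : 0 < d := Module.finrank_pos
  have hcd : Continuous fun x => fderiv ℝ a x x :=
    (ha.continuous_fderiv one_ne_zero).clm_apply continuous_id
  set f : E → ℝ := fun x => d * a x + fderiv ℝ a x x with hf
  have hfc : Continuous f := (continuous_const.mul ha.continuous).add hcd
  have hfi : Integrable ((Metric.ball (0 : E) 1).indicator f) μ := by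
    rw [integrable_indicator_iff measurableSet_ball]
    exact (hfc.continuousOn.integrableOn_compact (isCompact_closedBall (0 : E) 1)).mono_set
      Metric.ball_subset_closedBall
  rw [← integral_indicator measurableSet_ball, integral_eq_integral_toSphere μ hfi]
  refine integral_congr_ae (Filter.Eventually.of_forall fun θ => ?_)
  have hθ : ‖(θ : E)‖ = 1 := by simp
  have h1 : ∀ r ∈ Set.Ioi (0 : ℝ),
      r ^ (d - 1) * (Metric.ball (0 : E) 1).indicator f (r • (θ : E)) =
        (Set.Iio (1 : ℝ)).indicator (fun r => r ^ (d - 1) * f (r • (θ : E))) r := by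
    intro r hr
    have hr0 : (0 : ℝ) < r := hr
    by_cases h : r < 1
    · rw [Set.indicator_of_mem, Set.indicator_of_mem (by exact h)]
      simp [norm_smul, hθ, abs_of_pos hr0, h]
    · rw [Set.indicator_of_notMem, Set.indicator_of_notMem (by exact h), mul_zero]
      simpa [norm_smul, hθ, abs_of_pos hr0] using h
  -- On each ray the integrand, with its polar weight, is an exact derivative, so the radial
  -- integral is just the boundary value at `r = 1`; the value at `0` vanishes because `d > 0`.
  have hder : ∀ r : ℝ, HasDerivAt (fun r : ℝ => r ^ d * a (r • (θ : E)))
      (r ^ (d - 1) * f (r • (θ : E))) r := by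
    intro r
    have e1 : HasDerivAt (fun r : ℝ => r • (θ : E)) (θ : E) r := by
      simpa using (hasDerivAt_id r).smul_const (θ : E)
    have e2 : HasDerivAt (fun r : ℝ => a (r • (θ : E))) (fderiv ℝ a (r • (θ : E)) θ) r :=
      ((ha.differentiable one_ne_zero _).hasFDerivAt).comp_hasDerivAt r e1
    refine ((hasDerivAt_pow d r).mul e2).congr_deriv ?_
    obtain ⟨e, he⟩ : ∃ e, d = e + 1 := ⟨d - 1, by omega⟩
    simp only [hf, he, map_smul, smul_eq_mul]
    push_cast
    ring
  have hcont : Continuous fun r : ℝ => r ^ (d - 1) * f (r • (θ : E)) := by fun_prop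
  change a θ = ∫ r in Set.Ioi (0 : ℝ),
    r ^ (d - 1) * (Metric.ball (0 : E) 1).indicator f (r • (θ : E))
  rw [setIntegral_congr_fun measurableSet_Ioi h1, setIntegral_indicator measurableSet_Iio,
    Set.Ioi_inter_Iio, ← integral_Ioc_eq_integral_Ioo, ← intervalIntegral.integral_of_le zero_le_one,
    intervalIntegral.integral_eq_sub_of_hasDerivAt (fun r _ => hder r)
      (hcont.intervalIntegrable _ _)]
  simp [hdpos.ne']

end Polar

/-- Euclidean space of dimension `n`. -/
abbrev Euc (n : ℕ) := EuclideanSpace ℝ (Fin n)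

/-- The standard basis vectors of Euclidean space. -/
noncomputable abbrev basisVec {n : ℕ} (i : Fin n) : Euc n := EuclideanSpace.single i (1 : ℝ)

/-! ### Weak gradients, test functions and the `H¹` norm -/

section Gradient

variable {n : ℕ}

theorem inner_gradient_eq_fderiv (f : Euc n → ℝ) (x v : Euc n) :
    inner ℝ (gradient f x) v = fderiv ℝ f x v := by
  rw [← toDual_gradient, InnerProductSpace.toDual_apply_apply]

theorem inner_eq_sum_inner_basisVec (a b : Euc n) :
    inner ℝ a b = ∑ i, inner ℝ a (basisVec i) * inner ℝ b (basisVec i) := by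
  rw [PiLp.inner_apply]
  refine Finset.sum_congr rfl fun i _ => ?_
  simp [EuclideanSpace.inner_single_right, mul_comm]

theorem contDiff_fderiv_apply {f : Euc n → ℝ} (hf : ContDiff ℝ ∞ f) (v : Euc n) :
    ContDiff ℝ ∞ fun x => fderiv ℝ f x v :=
  (hf.fderiv_right (by simp)).clm_apply contDiff_const

theorem continuous_gradient {f : Euc n → ℝ} (hf : ContDiff ℝ ∞ f) :
    Continuous (gradient f) :=
  (InnerProductSpace.toDual ℝ (Euc n)).symm.continuous.comp (hf.continuous_fderiv (by simp))

theorem memLp_restrict_of_continuous {F : Type*} [NormedAddCommGroup F] {D : Set (Euc n)}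
    (hD : Bornology.IsBounded D) {f : Euc n → F} (hf : Continuous f) (p : ℝ≥0∞) :
    MemLp f p (volume.restrict D) := by
  have hK : IsCompact (closure D) := hD.isCompact_closure
  have : IsFiniteMeasure ((volume : Measure (Euc n)).restrict (closure D)) :=
    ⟨by rw [Measure.restrict_apply_univ]; exact hK.measure_lt_top⟩
  obtain ⟨C, hC⟩ := hK.exists_bound_of_continuousOn hf.continuousOn
  refine MemLp.mono_measure (Measure.restrict_mono subset_closure le_rfl) ?_
  refine MemLp.of_bound (hf.continuousOn.aestronglyMeasurable_of_isCompact hK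
    isClosed_closure.measurableSet) C ?_
  exact (ae_restrict_iff' isClosed_closure.measurableSet).2 (Filter.Eventually.of_forall hC)

theorem integrableOn_of_continuous {D : Set (Euc n)} (hD : Bornology.IsBounded D) {f : Euc n → ℝ}
    (hf : Continuous f) : IntegrableOn f D :=
  memLp_one_iff_integrable.1 (memLp_restrict_of_continuous hD hf 1)

theorem integrable_mul_of_memLp_two {α : Type*} [MeasurableSpace α] {μ : Measure α} {f g : α → ℝ}
    (hf : MemLp f 2 μ) (hg : MemLp g 2 μ) : Integrable (fun x => f x * g x) μ :=
  hf.integrable_mul hg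

theorem IsTestFunction.mul_left {D : Set (Euc n)} {f φ : Euc n → ℝ} (hφ : IsTestFunction D φ)
    (hf : ContDiff ℝ ∞ f) : IsTestFunction D fun x => f x * φ x :=
  ⟨hf.mul hφ.1, hφ.2.1.mul_left,
    (closure_mono (Function.support_mul_subset_right f φ)).trans hφ.2.2⟩

theorem IsTestFunction.memLp {D : Set (Euc n)} {φ : Euc n → ℝ} (hφ : IsTestFunction D φ)
    (p : ℝ≥0∞) : MemLp φ p (volume.restrict D) :=
  (hφ.1.continuous.memLp_of_hasCompactSupport hφ.2.1).restrict D

theorem IsTestFunction.memLp_fderiv {D : Set (Euc n)} {φ : Euc n → ℝ} (hφ : IsTestFunction D φ)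
    (v : Euc n) (p : ℝ≥0∞) : MemLp (fun x => fderiv ℝ φ x v) p (volume.restrict D) :=
  ((contDiff_fderiv_apply hφ.1 v).continuous.memLp_of_hasCompactSupport
    (hφ.2.1.fderiv_apply ℝ v)).restrict D

theorem IsTestFunction.eq_zero {D : Set (Euc n)} {φ : Euc n → ℝ} (hφ : IsTestFunction D φ)
    {x : Euc n} (hx : x ∉ D) : φ x = 0 :=
  image_eq_zero_of_notMem_tsupport fun h => hx (hφ.2.2 h)

theorem IsTestFunction.fderiv_eq_zero {D : Set (Euc n)} {φ : Euc n → ℝ} (hφ : IsTestFunction D φ)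
    {x : Euc n} (hx : x ∉ D) (v : Euc n) : fderiv ℝ φ x v = 0 :=
  image_eq_zero_of_notMem_tsupport (f := fun x => fderiv ℝ φ x v)
    fun h => hx (hφ.2.2 (tsupport_fderiv_apply_subset ℝ v h))

/-- Integration by parts against a test function. -/
theorem setIntegral_mul_fderiv_eq {D : Set (Euc n)} {f φ : Euc n → ℝ} (hf : ContDiff ℝ ∞ f)
    (hφ : IsTestFunction D φ) (v : Euc n) :
    ∫ x in D, f x * fderiv ℝ φ x v = -∫ x in D, fderiv ℝ f x v * φ x := by
  rw [setIntegral_eq_integral_of_forall_compl_eq_zero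
      (fun x hx => by rw [hφ.fderiv_eq_zero hx, mul_zero]),
    setIntegral_eq_integral_of_forall_compl_eq_zero
      (fun x hx => by rw [hφ.eq_zero hx, mul_zero])]
  have hfv := contDiff_fderiv_apply hf v
  have hφv := contDiff_fderiv_apply hφ.1 v
  exact integral_mul_fderiv_eq_neg_fderiv_mul_of_integrable
    ((hfv.continuous.mul hφ.1.continuous).integrable_of_hasCompactSupport hφ.2.1.mul_left)
    ((hf.continuous.mul hφv.continuous).integrable_of_hasCompactSupport
      (hφ.2.1.fderiv_apply ℝ v).mul_left)
    ((hf.continuous.mul hφ.1.continuous).integrable_of_hasCompactSupport hφ.2.1.mul_left)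
    (fun x _ => hf.differentiable (by simp) x) (fun x _ => hφ.1.differentiable (by simp) x)

theorem hasWeakGradient_gradient {D : Set (Euc n)} (hD : Bornology.IsBounded D) {f : Euc n → ℝ}
    (hf : ContDiff ℝ ∞ f) : HasWeakGradient D f (gradient f) where
  memLp := memLp_restrict_of_continuous hD hf.continuous 2
  memLp_grad := memLp_restrict_of_continuous hD (continuous_gradient hf) 2
  integral_eq φ hφ v := by
    simp only [inner_gradient_eq_fderiv]
    exact setIntegral_mul_fderiv_eq hf hφ v

theorem HasWeakGradient.memLp_inner {D : Set (Euc n)} {u : Euc n → ℝ} {G : Euc n → Euc n}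
    (h : HasWeakGradient D u G) (v : Euc n) :
    MemLp (fun x => inner ℝ (G x) v) 2 (volume.restrict D) :=
  h.memLp_grad.inner_const v

theorem HasWeakGradient.sub {D : Set (Euc n)} {u v : Euc n → ℝ} {G H : Euc n → Euc n}
    (hu : HasWeakGradient D u G) (hv : HasWeakGradient D v H) :
    HasWeakGradient D (fun x => u x - v x) (fun x => G x - H x) where
  memLp := hu.memLp.sub hv.memLp
  memLp_grad := hu.memLp_grad.sub hv.memLp_grad
  integral_eq φ hφ w := by
    have i1 := integrable_mul_of_memLp_two hu.memLp (hφ.memLp_fderiv w 2)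
    have i2 := integrable_mul_of_memLp_two hv.memLp (hφ.memLp_fderiv w 2)
    have i3 := integrable_mul_of_memLp_two (hu.memLp_inner w) (hφ.memLp 2)
    have i4 := integrable_mul_of_memLp_two (hv.memLp_inner w) (hφ.memLp 2)
    simp only [sub_mul, inner_sub_left]
    rw [integral_sub i1 i2, integral_sub i3 i4, hu.integral_eq φ hφ w, hv.integral_eq φ hφ w]
    ring

/-- The weak gradient on an open set is unique. -/
theorem HasWeakGradient.ae_eq {D : Set (Euc n)} (hD : IsOpen D) {u : Euc n → ℝ}
    {G H : Euc n → Euc n} (hG : HasWeakGradient D u G) (hH : HasWeakGradient D u H) :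
    G =ᵐ[volume.restrict D] H := by
  have key : ∀ i : Fin n, ∀ᵐ x ∂(volume : Measure (Euc n)), x ∈ D →
      inner ℝ (G x - H x) (basisVec i) = 0 := by
    intro i
    have hm : MemLp (fun x => inner ℝ (G x - H x) (basisVec i)) 2 (volume.restrict D) :=
      (hG.memLp_grad.sub hH.memLp_grad).inner_const _
    refine hD.ae_eq_zero_of_integral_contDiff_smul_eq_zero
      (locallyIntegrableOn_of_locallyIntegrable_restrict
        (hm.locallyIntegrable (by norm_num))) fun φ h1 h2 h3 => ?_
    have hφ : IsTestFunction D φ := ⟨h1, h2, h3⟩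
    have e := (hG.sub hH).integral_eq φ hφ (basisVec i)
    simp only [sub_self, zero_mul, integral_zero] at e
    rw [← setIntegral_eq_integral_of_forall_compl_eq_zero (s := D)
      (fun x hx => by rw [hφ.eq_zero hx, zero_smul])]
    simp only [smul_eq_mul, mul_comm (φ _)]
    linarith
  rw [Filter.EventuallyEq, ae_restrict_iff' hD.measurableSet]
  filter_upwards [ae_all_iff.2 key] with x hx hxD
  ext i
  have := hx i hxD
  simp only [EuclideanSpace.inner_single_right] at this
  simpa [sub_eq_zero] using this

/-- Weak gradients on an open set agree almost everywhere, so all terms of the infimum coincide. -/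
theorem h1Norm_eq {D : Set (Euc n)} (hD : IsOpen D) {u : Euc n → ℝ} {G : Euc n → Euc n}
    (hG : HasWeakGradient D u G) :
    h1Norm D u = (eLpNorm u 2 (volume.restrict D) ^ 2 +
      eLpNorm G 2 (volume.restrict D) ^ 2) ^ (1 / 2 : ℝ) := by
  refine le_antisymm (iInf₂_le G hG) (le_iInf₂ fun H hH => ?_)
  rw [eLpNorm_congr_ae (hG.ae_eq hD hH)]

end Gradient

/-! ### Solid harmonics and radial test functions -/

section SolidHarmonic

variable {n : ℕ}

/-- Smooth harmonic functions on Euclidean space that are homogeneous of degree `k`. -/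
structure IsSolidHarmonic (p : Euc n → ℝ) (k : ℕ) : Prop where
  contDiff : ContDiff ℝ ∞ p
  map_smul : ∀ (c : ℝ) (x : Euc n), p (c • x) = c ^ k * p x
  laplacian_eq_zero : ∀ x : Euc n,
    ∑ i, fderiv ℝ (fun y => fderiv ℝ p y (basisVec i)) x (basisVec i) = 0

/-- Euler's identity, for functions with `c ^ e * f (c • x) = c ^ d * f x`. -/
theorem fderiv_self_of_homogeneous {f : Euc n → ℝ} {d e : ℕ} (hf : Differentiable ℝ f)
    (h : ∀ (c : ℝ) (x : Euc n), c ^ e * f (c • x) = c ^ d * f x) (x : Euc n) :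
    fderiv ℝ f x x = (d - e) * f x := by
  have h1 : HasDerivAt (fun c : ℝ => c ^ e * f (c • x)) (e * f x + fderiv ℝ f x x) 1 := by
    have e1 : HasDerivAt (fun r : ℝ => r • x) x 1 := by
      simpa using (hasDerivAt_id (1 : ℝ)).smul_const x
    have e2 : HasDerivAt (fun r : ℝ => f (r • x)) (fderiv ℝ f ((1 : ℝ) • x) x) 1 :=
      ((hf _).hasFDerivAt).comp_hasDerivAt 1 e1
    simpa using (hasDerivAt_pow e (1 : ℝ)).fun_mul e2
  have h2 : HasDerivAt (fun c : ℝ => c ^ d * f x) (d * f x) 1 := by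
    simpa using (hasDerivAt_pow d (1 : ℝ)).mul_const (f x)
  simp only [h] at h1
  linarith [h1.unique h2]

theorem IsSolidHarmonic.fderiv_self {p : Euc n → ℝ} {k : ℕ} (hp : IsSolidHarmonic p k)
    (x : Euc n) : fderiv ℝ p x x = k * p x := by
  have := fderiv_self_of_homogeneous (d := k) (e := 0) (hp.contDiff.differentiable (by simp))
    (fun c y => by rw [hp.map_smul, pow_zero, one_mul]) x
  simpa using this

/-- Solid harmonics are weakly harmonic. -/
theorem IsSolidHarmonic.integral_inner_gradient {p : Euc n → ℝ} {k : ℕ}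
    (hp : IsSolidHarmonic p k) {D : Set (Euc n)} {φ : Euc n → ℝ}
    (hφ : IsTestFunction D φ) : ∫ x in D, inner ℝ (gradient p x) (gradient φ x) = 0 := by
  have h1 : ∀ x, inner ℝ (gradient p x) (gradient φ x) =
      ∑ i, fderiv ℝ p x (basisVec i) * fderiv ℝ φ x (basisVec i) := by
    intro x
    rw [inner_eq_sum_inner_basisVec]
    simp only [inner_gradient_eq_fderiv]
  have hpi := fun i : Fin n => contDiff_fderiv_apply hp.contDiff (basisVec i)
  have e1 : ∀ i : Fin n, IntegrableOn
      (fun x => fderiv ℝ p x (basisVec i) * fderiv ℝ φ x (basisVec i)) D := fun i =>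
    (((hpi i).continuous.mul (contDiff_fderiv_apply hφ.1 _).continuous
      ).integrable_of_hasCompactSupport
      (hφ.2.1.fderiv_apply ℝ _).mul_left).integrableOn
  have e2 : ∀ i : Fin n, IntegrableOn
      (fun x => fderiv ℝ (fun y => fderiv ℝ p y (basisVec i)) x (basisVec i) * φ x) D := fun i =>
    (((contDiff_fderiv_apply (hpi i) _).continuous.mul hφ.1.continuous
      ).integrable_of_hasCompactSupport hφ.2.1.mul_left).integrableOn
  simp only [h1]
  rw [integral_finsetSum _ fun i _ => e1 i]
  simp only [setIntegral_mul_fderiv_eq (hpi _) hφ]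
  rw [Finset.sum_neg_distrib, ← integral_finsetSum _ fun i _ => e2 i]
  simp only [← Finset.sum_mul, hp.laplacian_eq_zero, zero_mul, integral_zero, neg_zero]

theorem hasFDerivAt_comp_norm_sq {θ : ℝ → ℝ} (hθ : ContDiff ℝ ∞ θ) (x : Euc n) :
    HasFDerivAt (fun x : Euc n => θ (‖x‖ ^ 2)) (deriv θ (‖x‖ ^ 2) • (2 • innerSL ℝ x)) x :=
  ((hθ.differentiable (by simp) _).hasDerivAt).comp_hasFDerivAt x
    (hasStrictFDerivAt_norm_sq x).hasFDerivAt

theorem fderiv_comp_norm_sq {θ : ℝ → ℝ} (hθ : ContDiff ℝ ∞ θ) (x v : Euc n) :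
    fderiv ℝ (fun x : Euc n => θ (‖x‖ ^ 2)) x v = deriv θ (‖x‖ ^ 2) * (2 * inner ℝ x v) := by
  rw [(hasFDerivAt_comp_norm_sq hθ x).fderiv]
  simp

theorem contDiff_comp_norm_sq {θ : ℝ → ℝ} (hθ : ContDiff ℝ ∞ θ) :
    ContDiff ℝ ∞ (fun x : Euc n => θ (‖x‖ ^ 2)) :=
  hθ.comp (contDiff_norm_sq ℝ)

theorem fderiv_comp_norm_sq_mul {θ : ℝ → ℝ} (hθ : ContDiff ℝ ∞ θ) {f : Euc n → ℝ}
    (hf : ContDiff ℝ ∞ f) (x v : Euc n) :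
    fderiv ℝ (fun x : Euc n => f x * θ (‖x‖ ^ 2)) x v =
      θ (‖x‖ ^ 2) * fderiv ℝ f x v + deriv θ (‖x‖ ^ 2) * (2 * inner ℝ x v) * f x := by
  rw [fderiv_fun_mul (hf.differentiable (by simp) x)
    ((contDiff_comp_norm_sq hθ).differentiable (by simp) x)]
  simp [fderiv_comp_norm_sq hθ]
  ring

theorem isTestFunction_comp_norm_sq {θ : ℝ → ℝ} (hθ : ContDiff ℝ ∞ θ) {ε : ℝ} (hε : 0 < ε)
    (h : ∀ s, 1 - ε ≤ s → θ s = 0) :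
    IsTestFunction (Metric.ball (0 : Euc n) 1) (fun x => θ (‖x‖ ^ 2)) := by
  have hsub : tsupport (fun x : Euc n => θ (‖x‖ ^ 2)) ⊆ {x : Euc n | ‖x‖ ^ 2 ≤ 1 - ε} := by
    refine closure_minimal (fun x hx => ?_) (isClosed_le (by fun_prop) continuous_const)
    by_contra hx'
    exact hx (h _ (not_le.1 hx').le)
  have hball : {x : Euc n | ‖x‖ ^ 2 ≤ 1 - ε} ⊆ Metric.ball (0 : Euc n) 1 := by
    intro x hx
    have hx : ‖x‖ ^ 2 ≤ 1 - ε := hx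
    rw [mem_ball_zero_iff]
    nlinarith [norm_nonneg x]
  refine ⟨contDiff_comp_norm_sq hθ, ?_, hsub.trans hball⟩
  exact (isCompact_closedBall (0 : Euc n) 1).of_isClosed_subset (isClosed_tsupport _)
    ((hsub.trans hball).trans Metric.ball_subset_closedBall)

/-- The weak gradient identity in direction `i` is tested with `∂ᵢp · θ(‖x‖²)` and summed over `i`.
Since `Δp = 0`, the divergence of `θ ∇p` is `2 θ' x · ∇p`, which Euler's identity turns into `2 k θ'
p`. -/
theorem IsSolidHarmonic.radial_integral_eq_zero {p : Euc n → ℝ} {k : ℕ}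
    (hp : IsSolidHarmonic p k) {u : Euc n → ℝ} {G : Euc n → Euc n}
    (hu : HasWeakGradient (Metric.ball 0 1) u G) {θ : ℝ → ℝ} (hθ : ContDiff ℝ ∞ θ) {ε : ℝ}
    (hε : 0 < ε) (h : ∀ s, 1 - ε ≤ s → θ s = 0) :
    ∫ x in Metric.ball (0 : Euc n) 1, (θ (‖x‖ ^ 2) * inner ℝ (G x) (gradient p x) +
      deriv θ (‖x‖ ^ 2) * (2 * k * (u x * p x))) = 0 := by
  have hpi := fun i : Fin n => contDiff_fderiv_apply hp.contDiff (basisVec i)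
  have hT : ∀ i : Fin n, IsTestFunction (Metric.ball (0 : Euc n) 1)
      (fun x => fderiv ℝ p x (basisVec i) * θ (‖x‖ ^ 2)) := fun i =>
    (isTestFunction_comp_norm_sq hθ hε h).mul_left (hpi i)
  have i1 : ∀ i : Fin n, IntegrableOn (fun x => u x *
      fderiv ℝ (fun x => fderiv ℝ p x (basisVec i) * θ (‖x‖ ^ 2)) x (basisVec i))
      (Metric.ball 0 1) := fun i => integrable_mul_of_memLp_two hu.memLp ((hT i).memLp_fderiv _ 2)
  have i2 : ∀ i : Fin n, IntegrableOn (fun x => inner ℝ (G x) (basisVec i) *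
      (fderiv ℝ p x (basisVec i) * θ (‖x‖ ^ 2))) (Metric.ball 0 1) := fun i =>
    integrable_mul_of_memLp_two (hu.memLp_inner _) ((hT i).memLp 2)
  have e : ∀ i : Fin n, ∫ x in Metric.ball (0 : Euc n) 1, (u x *
      fderiv ℝ (fun x => fderiv ℝ p x (basisVec i) * θ (‖x‖ ^ 2)) x (basisVec i) +
      inner ℝ (G x) (basisVec i) * (fderiv ℝ p x (basisVec i) * θ (‖x‖ ^ 2))) = 0 := fun i => by
    rw [integral_add (i1 i) (i2 i), hu.integral_eq _ (hT i) (basisVec i)]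
    ring
  have i3 : ∀ i : Fin n, IntegrableOn (fun x => u x *
      fderiv ℝ (fun x => fderiv ℝ p x (basisVec i) * θ (‖x‖ ^ 2)) x (basisVec i) +
      inner ℝ (G x) (basisVec i) * (fderiv ℝ p x (basisVec i) * θ (‖x‖ ^ 2)))
      (Metric.ball 0 1) := fun i => (i1 i).add (i2 i)
  have e' := Finset.sum_eq_zero fun i (_ : i ∈ Finset.univ) => e i
  rw [← integral_finsetSum _ fun i _ => i3 i] at e'
  rw [← e']
  refine integral_congr_ae (Filter.Eventually.of_forall fun x => ?_)
  simp only [fderiv_comp_norm_sq_mul hθ (hpi _)]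
  have s1 : inner ℝ (G x) (gradient p x) =
      ∑ i, inner ℝ (G x) (basisVec i) * fderiv ℝ p x (basisVec i) := by
    rw [inner_eq_sum_inner_basisVec]
    simp only [inner_gradient_eq_fderiv]
  have s2 : (k : ℝ) * p x = ∑ i, inner ℝ x (basisVec i) * fderiv ℝ p x (basisVec i) := by
    rw [← hp.fderiv_self, ← inner_gradient_eq_fderiv, real_inner_comm, inner_eq_sum_inner_basisVec]
    simp only [inner_gradient_eq_fderiv]
  have s3 := hp.laplacian_eq_zero x
  -- A vanishing Laplacian term is added so that both sides can be compared summand by summand.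
  have s4 : deriv θ (‖x‖ ^ 2) * (2 * k * (u x * p x)) =
      deriv θ (‖x‖ ^ 2) * 2 * u x * ∑ i, inner ℝ x (basisVec i) * fderiv ℝ p x (basisVec i) +
      u x * θ (‖x‖ ^ 2) *
        ∑ i, fderiv ℝ (fun y => fderiv ℝ p y (basisVec i)) x (basisVec i) := by
    rw [s3, ← s2]
    ring
  rw [s4, s1, Finset.mul_sum, Finset.mul_sum, Finset.mul_sum, ← Finset.sum_add_distrib,
    ← Finset.sum_add_distrib]
  refine Finset.sum_congr rfl fun i _ => ?_
  ring

/-- This is the weak equation tested with `p θ(‖x‖²)`, whose gradient is `θ ∇p + 2 θ' p x`. It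
shares its first term with `IsSolidHarmonic.radial_integral_eq_zero`, so comparing the two
eliminates `∇p`. -/
theorem IsSolidHarmonic.radial_integral_eq_zero_of_harmonic {p : Euc n → ℝ} {k : ℕ}
    (hp : IsSolidHarmonic p k) {G : Euc n → Euc n}
    (hG : ∀ φ, IsTestFunction (Metric.ball 0 1) φ →
      ∫ x in Metric.ball (0 : Euc n) 1, inner ℝ (G x) (gradient φ x) = 0)
    {θ : ℝ → ℝ} (hθ : ContDiff ℝ ∞ θ) {ε : ℝ}
    (hε : 0 < ε) (h : ∀ s, 1 - ε ≤ s → θ s = 0) :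
    ∫ x in Metric.ball (0 : Euc n) 1, (θ (‖x‖ ^ 2) * inner ℝ (G x) (gradient p x) +
      deriv θ (‖x‖ ^ 2) * (2 * (inner ℝ (G x) x * p x))) = 0 := by
  rw [← hG _ ((isTestFunction_comp_norm_sq hθ hε h).mul_left hp.contDiff)]
  refine integral_congr_ae (Filter.Eventually.of_forall fun x => ?_)
  have hg : gradient (fun x => p x * θ (‖x‖ ^ 2)) x =
      θ (‖x‖ ^ 2) • gradient p x + (deriv θ (‖x‖ ^ 2) * 2 * p x) • x := by
    refine ext_inner_right ℝ fun v => ?_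
    rw [inner_gradient_eq_fderiv, fderiv_comp_norm_sq_mul hθ hp.contDiff, inner_add_left,
      inner_smul_left, inner_smul_left, inner_gradient_eq_fderiv]
    simp
    ring
  simp only [hg, inner_add_right, inner_smul_right]
  ring

end SolidHarmonic

/-! ### Removing the support condition at the sphere -/

section Cutoff

variable {n : ℕ}

/-- The derivative has compact support. The weight `y + 1` is the rescaled distance `l (1 - s)` to
the boundary in `radialCutoff`, so the bound is uniform in `l`. -/
theorem exists_bound_smoothTransition_deriv :
    ∃ C : ℝ, ∀ y : ℝ, |(y + 1) * deriv Real.smoothTransition y| ≤ C := by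
  have hc : Continuous (deriv Real.smoothTransition) :=
    (Real.smoothTransition.contDiff (n := 1)).continuous_deriv le_rfl
  have hs : HasCompactSupport (deriv Real.smoothTransition) := by
    refine HasCompactSupport.intro (K := Set.Icc 0 1) isCompact_Icc fun x hx => ?_
    rw [Set.mem_Icc, not_and_or, not_le, not_le] at hx
    rcases hx with hx | hx
    · have : Real.smoothTransition =ᶠ[𝓝 x] fun _ => 0 := by
        filter_upwards [Iio_mem_nhds hx] with y hy
        exact Real.smoothTransition.zero_of_nonpos (le_of_lt hy)
      rw [this.deriv_eq, deriv_const]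
    · have : Real.smoothTransition =ᶠ[𝓝 x] fun _ => 1 := by
        filter_upwards [Ioi_mem_nhds hx] with y hy
        exact Real.smoothTransition.one_of_one_le (le_of_lt hy)
      rw [this.deriv_eq, deriv_const]
  obtain ⟨C, hC⟩ := (hs.mul_left (f := fun y : ℝ => y + 1)).exists_bound_of_continuous
    (by fun_prop : Continuous fun y : ℝ => (y + 1) * deriv Real.smoothTransition y)
  exact ⟨C, hC⟩

/-- The cutoff function `s ↦ χ (l (1 - s) - 1)`, which vanishes for `s ≥ 1 - 1 / l`. -/
noncomputable def radialCutoff (l : ℝ) (s : ℝ) : ℝ := Real.smoothTransition (l * (1 - s) - 1)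

theorem contDiff_radialCutoff (l : ℝ) : ContDiff ℝ ∞ (radialCutoff l) :=
  (Real.smoothTransition.contDiff (n := ⊤)).comp
    (by fun_prop : ContDiff ℝ ∞ fun s : ℝ => l * (1 - s) - 1)

theorem hasDerivAt_radialCutoff (l s : ℝ) :
    HasDerivAt (radialCutoff l) (-(l * deriv Real.smoothTransition (l * (1 - s) - 1))) s := by
  have h1 : HasDerivAt (fun s : ℝ => l * (1 - s) - 1) (-l) s := by
    simpa using (((hasDerivAt_id s).const_sub 1).const_mul l).sub_const 1
  have h2 := ((Real.smoothTransition.contDiff (n := 1)).differentiable one_ne_zero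
    (l * (1 - s) - 1)).hasDerivAt
  exact (h2.comp s h1).congr_deriv (by ring)

/-- An identity for radial multipliers vanishing near the unit sphere extends to those that merely
vanish on it. -/
theorem radial_integral_eq_zero_of_cutoff {f₁ f₂ : Euc n → ℝ}
    (hf₁ : IntegrableOn f₁ (Metric.ball 0 1)) (hf₂ : IntegrableOn f₂ (Metric.ball 0 1))
    (H : ∀ θ : ℝ → ℝ, ContDiff ℝ ∞ θ → ∀ ε : ℝ, 0 < ε → (∀ s, 1 - ε ≤ s → θ s = 0) →
      ∫ x in Metric.ball (0 : Euc n) 1, (θ (‖x‖ ^ 2) * f₁ x + deriv θ (‖x‖ ^ 2) * f₂ x) = 0)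
    {θ : ℝ → ℝ} (hθ : ContDiff ℝ ∞ θ) (h1 : θ 1 = 0) :
    ∫ x in Metric.ball (0 : Euc n) 1, (θ (‖x‖ ^ 2) * f₁ x + deriv θ (‖x‖ ^ 2) * f₂ x) = 0 := by
  obtain ⟨C, hC⟩ := exists_bound_smoothTransition_deriv
  have hC0 : 0 ≤ C := (abs_nonneg _).trans (hC 0)
  have hdc : Continuous (deriv θ) := hθ.continuous_deriv (by simp)
  obtain ⟨M, hM⟩ := (isCompact_Icc (a := (0 : ℝ)) (b := 1)).exists_bound_of_continuousOn
    hdc.continuousOn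
  have hM0 : 0 ≤ M := (norm_nonneg _).trans (hM 0 (by simp))
  -- First-order vanishing at `s = 1` is what compensates the factor `l + 1` in the derivative of
  -- the cutoff.
  have hθM : ∀ s ∈ Set.Icc (0 : ℝ) 1, |θ s| ≤ M * (1 - s) := by
    intro s hs
    have := Convex.norm_image_sub_le_of_norm_deriv_le (𝕜 := ℝ) (f := θ) (s := Set.Icc 0 1) (x := 1)
      (y := s) (fun x _ => hθ.differentiable (by simp) x) hM (convex_Icc 0 1) (by simp) hs
    rw [h1, sub_zero, Real.norm_eq_abs, Real.norm_eq_abs, abs_sub_comm,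
      abs_of_nonneg (sub_nonneg.2 hs.2)] at this
    exact this
  set T : ℕ → ℝ → ℝ := fun l s => θ s * radialCutoff (l + 1) s with hT
  have hTc : ∀ l, ContDiff ℝ ∞ (T l) := fun l => hθ.mul (contDiff_radialCutoff _)
  have hTd : ∀ l s, deriv (T l) s = deriv θ s * radialCutoff (l + 1) s -
      θ s * ((l + 1) * deriv Real.smoothTransition ((l + 1) * (1 - s) - 1)) := by
    intro l s
    rw [(((hθ.differentiable (by simp) s).hasDerivAt).fun_mul (hasDerivAt_radialCutoff _ s)).deriv]
    ring
  have hcut : ∀ l s, |radialCutoff l s| ≤ 1 := fun l s => by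
    rw [radialCutoff, abs_of_nonneg (Real.smoothTransition.nonneg _)]
    exact Real.smoothTransition.le_one _
  have hzero : ∀ l : ℕ, ∫ x in Metric.ball (0 : Euc n) 1,
      (T l (‖x‖ ^ 2) * f₁ x + deriv (T l) (‖x‖ ^ 2) * f₂ x) = 0 := by
    intro l
    refine H (T l) (hTc l) (1 / ((l : ℝ) + 1)) (by positivity) fun s hs => ?_
    have : radialCutoff ((l : ℝ) + 1) s = 0 := by
      refine Real.smoothTransition.zero_of_nonpos ?_
      have h2 : 1 - s ≤ 1 / ((l : ℝ) + 1) := by linarith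
      rw [le_div_iff₀ (by positivity)] at h2
      linarith
    simp [hT, this]
  have hlim := tendsto_integral_of_dominated_convergence
    (μ := volume.restrict (Metric.ball (0 : Euc n) 1))
    (F := fun (l : ℕ) x => T l (‖x‖ ^ 2) * f₁ x + deriv (T l) (‖x‖ ^ 2) * f₂ x)
    (f := fun x => θ (‖x‖ ^ 2) * f₁ x + deriv θ (‖x‖ ^ 2) * f₂ x)
    (fun x => M * |f₁ x| + (M + M * C) * |f₂ x|)
    (fun l => ?_) ?_ (fun l => ?_) ?_
  · simp only [hzero] at hlim
    exact (tendsto_nhds_unique tendsto_const_nhds hlim).symm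
  · have c1 : Continuous fun x : Euc n => T l (‖x‖ ^ 2) := (hTc l).continuous.comp (by fun_prop)
    have c2 : Continuous fun x : Euc n => deriv (T l) (‖x‖ ^ 2) :=
      ((hTc l).continuous_deriv (by simp)).comp (by fun_prop)
    exact (c1.aestronglyMeasurable.mul hf₁.aestronglyMeasurable).add
      (c2.aestronglyMeasurable.mul hf₂.aestronglyMeasurable)
  · exact (hf₁.abs.const_mul _).add (hf₂.abs.const_mul _)
  · refine (ae_restrict_iff' measurableSet_ball).2 (Filter.Eventually.of_forall fun x hx => ?_)
    rw [mem_ball_zero_iff] at hx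
    have hs : ‖x‖ ^ 2 ∈ Set.Icc (0 : ℝ) 1 := ⟨by positivity, by nlinarith [norm_nonneg x]⟩
    set s := ‖x‖ ^ 2
    have b1 : |T l s| ≤ M := by
      rw [hT, abs_mul]
      calc |θ s| * |radialCutoff (l + 1) s| ≤ M * 1 :=
            mul_le_mul ((hθM s hs).trans (by nlinarith [hs.1])) (hcut _ _) (abs_nonneg _) hM0
        _ = M := mul_one M
    have b2 : |deriv (T l) s| ≤ M + M * C := by
      rw [hTd]
      refine (abs_sub _ _).trans (add_le_add ?_ ?_)
      · rw [abs_mul]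
        calc |deriv θ s| * |radialCutoff (l + 1) s| ≤ M * 1 :=
              mul_le_mul (hM s hs) (hcut _ _) (abs_nonneg _) hM0
          _ = M := mul_one M
      · have h3 := hC ((l + 1) * (1 - s) - 1)
        rw [sub_add_cancel, abs_mul, abs_mul, abs_of_nonneg (sub_nonneg.2 hs.2)] at h3
        rw [abs_mul, abs_mul]
        calc |θ s| * (|(l : ℝ) + 1| * |deriv Real.smoothTransition ((l + 1) * (1 - s) - 1)|)
            ≤ M * (1 - s) * (|(l : ℝ) + 1| * |deriv Real.smoothTransition ((l + 1) * (1 - s) - 1)|) :=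
              mul_le_mul_of_nonneg_right (hθM s hs) (by positivity)
          _ = M * (|(l : ℝ) + 1| * (1 - s) *
              |deriv Real.smoothTransition ((l + 1) * (1 - s) - 1)|) := by ring
          _ ≤ M * C := mul_le_mul_of_nonneg_left h3 hM0
    rw [Real.norm_eq_abs]
    refine (abs_add_le _ _).trans (add_le_add ?_ ?_)
    · rw [abs_mul]
      exact mul_le_mul_of_nonneg_right b1 (abs_nonneg _)
    · rw [abs_mul]
      exact mul_le_mul_of_nonneg_right b2 (abs_nonneg _)
  · refine (ae_restrict_iff' measurableSet_ball).2 (Filter.Eventually.of_forall fun x hx => ?_)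
    rw [mem_ball_zero_iff] at hx
    have hs1 : ‖x‖ ^ 2 < 1 := by nlinarith [norm_nonneg x]
    -- Agreement on a neighbourhood, not only at the point, so that the derivatives agree as well.
    have hev : ∀ᶠ l : ℕ in Filter.atTop, T l =ᶠ[𝓝 (‖x‖ ^ 2)] θ := by
      obtain ⟨t, ht1, ht2⟩ := exists_between hs1
      obtain ⟨N, hN⟩ := exists_nat_gt (2 / (1 - t))
      filter_upwards [Filter.eventually_ge_atTop N] with l hl
      filter_upwards [Iio_mem_nhds ht1] with s hs
      have hs : s < t := hs
      have : radialCutoff ((l : ℝ) + 1) s = 1 := by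
        refine Real.smoothTransition.one_of_one_le ?_
        rw [div_lt_iff₀ (by linarith)] at hN
        have hl' : (N : ℝ) ≤ l := by exact_mod_cast hl
        nlinarith
      simp [hT, this]
    refine Filter.Tendsto.congr' ?_ tendsto_const_nhds
    filter_upwards [hev] with l hl
    rw [hl.eq_of_nhds, hl.deriv_eq]

end Cutoff

/-! ### Radial moment identities on the unit ball -/

section BallIdentities

variable {n : ℕ} {p : Euc n → ℝ} {k : ℕ}

theorem HasWeakGradient.integrableOn_inner {u : Euc n → ℝ} {G : Euc n → Euc n}
    (hu : HasWeakGradient (Metric.ball 0 1) u G) {V : Euc n → Euc n} (hV : Continuous V) :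
    IntegrableOn (fun x => inner ℝ (G x) (V x)) (Metric.ball 0 1) := by
  have hVm : MemLp V 2 (volume.restrict (Metric.ball (0 : Euc n) 1)) :=
    memLp_restrict_of_continuous Metric.isBounded_ball hV 2
  refine (hu.memLp_grad.norm.integrable_mul hVm.norm).mono
    (hu.memLp_grad.aestronglyMeasurable.inner hVm.aestronglyMeasurable)
    (Filter.Eventually.of_forall fun x => ?_)
  simp only [Pi.mul_apply, norm_mul, norm_norm]
  exact norm_inner_le_norm _ _

theorem HasWeakGradient.integrableOn_mul {u : Euc n → ℝ} {G : Euc n → Euc n}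
    (hu : HasWeakGradient (Metric.ball 0 1) u G) {f : Euc n → ℝ} (hf : Continuous f) :
    IntegrableOn (fun x => u x * f x) (Metric.ball 0 1) :=
  integrable_mul_of_memLp_two hu.memLp
    (memLp_restrict_of_continuous Metric.isBounded_ball hf 2)

theorem HasWeakGradient.integrableOn_radial {u : Euc n → ℝ} {G : Euc n → Euc n}
    (hu : HasWeakGradient (Metric.ball 0 1) u G) (hp : IsSolidHarmonic p k) :
    IntegrableOn (fun x => inner ℝ (G x) x * p x) (Metric.ball 0 1) := by
  have h := hu.integrableOn_inner (V := fun x => p x • x)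
    (by have := hp.contDiff.continuous; fun_prop)
  refine h.congr (Filter.Eventually.of_forall fun x => ?_)
  simp only [inner_smul_right, mul_comm]

theorem integrableOn_radial_mul {f : Euc n → ℝ} (hf : IntegrableOn f (Metric.ball 0 1)) {b : ℝ → ℝ}
    (hb : Continuous b) : IntegrableOn (fun x => b (‖x‖ ^ 2) * f x) (Metric.ball 0 1) := by
  obtain ⟨C, hC⟩ := (isCompact_Icc (a := (0 : ℝ)) (b := 1)).exists_bound_of_continuousOn
    hb.continuousOn
  refine Integrable.bdd_mul (c := C) hf
    ((hb.comp (by fun_prop : Continuous fun x : Euc n => ‖x‖ ^ 2)).aestronglyMeasurable) ?_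
  refine (ae_restrict_iff' measurableSet_ball).2 (Filter.Eventually.of_forall fun x hx => ?_)
  rw [mem_ball_zero_iff] at hx
  exact hC _ ⟨by positivity, by nlinarith [norm_nonneg x]⟩

theorem IsSolidHarmonic.integral_inner_gradient_ball (hp : IsSolidHarmonic p k) {u : Euc n → ℝ}
    {G : Euc n → Euc n} (hu : HasWeakGradient (Metric.ball 0 1) u G) (i : ℕ) :
    ∫ x in Metric.ball (0 : Euc n) 1, ((‖x‖ ^ 2) ^ (i + 1) - 1) * inner ℝ (G x) (gradient p x) =
      -(2 * (i + 1) * k * ∫ x in Metric.ball (0 : Euc n) 1, (‖x‖ ^ 2) ^ i * (u x * p x)) := by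
  have hi : IntegrableOn (fun x => inner ℝ (G x) (gradient p x)) (Metric.ball 0 1) :=
    hu.integrableOn_inner (continuous_gradient hp.contDiff)
  have hup := hu.integrableOn_mul hp.contDiff.continuous
  -- Chosen to vanish at `s = 1` and to have the monomial `s ^ i`, up to the factor `i + 1`, as
  -- derivative.
  set θ : ℝ → ℝ := fun s => s ^ (i + 1) - 1 with hθ
  have hθc : ContDiff ℝ ∞ θ := by fun_prop
  have hθd : ∀ s, deriv θ s = (i + 1) * s ^ i := fun s => by simp [hθ]
  have e1 := radial_integral_eq_zero_of_cutoff hi (hup.const_mul (2 * k))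
    (fun θ hθ ε hε h => hp.radial_integral_eq_zero hu hθ hε h) hθc (by simp [hθ])
  rw [integral_add (integrableOn_radial_mul hi hθc.continuous)
    (integrableOn_radial_mul (hup.const_mul _) (hθc.continuous_deriv (by simp)))] at e1
  rw [eq_neg_of_add_eq_zero_left e1, ← integral_const_mul]
  congr 1
  refine integral_congr_ae (Filter.Eventually.of_forall fun x => ?_)
  simp only [hθd]
  ring

/-- Testing weak harmonicity of `u` with radial multiples of a solid harmonic of degree `k`:
in this sense `x · ∇u = k u`. -/
theorem IsSolidHarmonic.integral_radial_deriv (hp : IsSolidHarmonic p k) {u : Euc n → ℝ}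
    {G : Euc n → Euc n} (hu : HasWeakGradient (Metric.ball 0 1) u G)
    (hG : ∀ φ, IsTestFunction (Metric.ball 0 1) φ →
      ∫ x in Metric.ball (0 : Euc n) 1, inner ℝ (G x) (gradient φ x) = 0) (i : ℕ) :
    ∫ x in Metric.ball (0 : Euc n) 1, (‖x‖ ^ 2) ^ i * (inner ℝ (G x) x * p x) =
      k * ∫ x in Metric.ball (0 : Euc n) 1, (‖x‖ ^ 2) ^ i * (u x * p x) := by
  have hi : IntegrableOn (fun x => inner ℝ (G x) (gradient p x)) (Metric.ball 0 1) :=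
    hu.integrableOn_inner (continuous_gradient hp.contDiff)
  have hGp := hu.integrableOn_radial hp
  set θ : ℝ → ℝ := fun s => s ^ (i + 1) - 1 with hθ
  have hθc : ContDiff ℝ ∞ θ := by fun_prop
  have hθd : ∀ s, deriv θ s = (i + 1) * s ^ i := fun s => by simp [hθ]
  have e2 := radial_integral_eq_zero_of_cutoff hi (hGp.const_mul 2)
    (fun θ hθ ε hε h => hp.radial_integral_eq_zero_of_harmonic hG hθ hε h) hθc (by simp [hθ])
  rw [integral_add (integrableOn_radial_mul hi hθc.continuous)
    (integrableOn_radial_mul (hGp.const_mul _) (hθc.continuous_deriv (by simp))),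
    hp.integral_inner_gradient_ball hu i] at e2
  have e3 : ∫ x in Metric.ball (0 : Euc n) 1, deriv θ (‖x‖ ^ 2) * (2 * (inner ℝ (G x) x * p x)) =
      2 * (i + 1) * ∫ x in Metric.ball (0 : Euc n) 1, (‖x‖ ^ 2) ^ i * (inner ℝ (G x) x * p x) := by
    rw [← integral_const_mul]
    refine integral_congr_ae (Filter.Eventually.of_forall fun x => ?_)
    simp only [hθd]
    ring
  rw [e3] at e2
  have h2 : (2 * ((i : ℝ) + 1)) ≠ 0 := by positivity
  refine mul_left_cancel₀ h2 ?_
  linarith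

end BallIdentities

/-! ### Integrals of homogeneous functions -/

section Homogeneous

variable {n : ℕ}

theorem integral_sphereMeasure [Nontrivial (Euc n)] {a : Euc n → ℝ} (ha : ContDiff ℝ ∞ a) :
    ∫ θ : Metric.sphere (0 : Euc n) 1, a θ ∂sphereMeasure n =
      ∫ x in Metric.ball (0 : Euc n) 1, (n * a x + fderiv ℝ a x x) := by
  have h := integral_toSphere_eq_integral_ball (volume : Measure (Euc n))
    (ha.of_le (by exact_mod_cast le_top))
  rw [finrank_euclideanSpace_fin] at h
  exact h

/-- For `f` of degree `d - e`, Euler's identity makes the integrand of the divergence theorem a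
multiple of `f`. Keeping `d` and `e` apart avoids truncated subtraction, which matters for
gradients. -/
theorem integral_sphereMeasure_of_homogeneous [Nontrivial (Euc n)] {f : Euc n → ℝ} {d e : ℕ}
    (hf : ContDiff ℝ ∞ f) (h : ∀ (c : ℝ) (x : Euc n), c ^ e * f (c • x) = c ^ d * f x) :
    ∫ θ : Metric.sphere (0 : Euc n) 1, f θ ∂sphereMeasure n =
      (n + d - e) * ∫ x in Metric.ball (0 : Euc n) 1, f x := by
  rw [integral_sphereMeasure hf, ← integral_const_mul]
  refine integral_congr_ae (Filter.Eventually.of_forall fun x => ?_)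
  simp only [fderiv_self_of_homogeneous (hf.differentiable (by simp)) h]
  ring

theorem setIntegral_ball_half_of_homogeneous {f : Euc n → ℝ} {d e : ℕ}
    (h : ∀ (c : ℝ) (x : Euc n), c ^ e * f (c • x) = c ^ d * f x) :
    (1 / 2 : ℝ) ^ e * ∫ x in Metric.ball (0 : Euc n) (1 / 2), f x =
      (1 / 2) ^ (n + d) * ∫ x in Metric.ball (0 : Euc n) 1, f x := by
  have hs := Measure.setIntegral_comp_smul_of_pos (volume : Measure (Euc n)) f
    (Metric.ball 0 1) (by norm_num : (0 : ℝ) < 1 / 2)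
  rw [smul_unitBall_of_pos (by norm_num : (0 : ℝ) < 1 / 2), finrank_euclideanSpace_fin,
    smul_eq_mul, eq_inv_mul_iff_mul_eq₀ (by positivity)] at hs
  rw [← hs, pow_add, mul_left_comm, mul_assoc, ← integral_const_mul]
  simp only [h, integral_const_mul]

variable {p : Euc n → ℝ} {k : ℕ}

theorem IsSolidHarmonic.sq_homogeneous (hp : IsSolidHarmonic p k) (i : ℕ) (c : ℝ) (x : Euc n) :
    c ^ 0 * ((‖c • x‖ ^ 2) ^ i * (p (c • x) * p (c • x))) =
      c ^ (2 * k + 2 * i) * ((‖x‖ ^ 2) ^ i * (p x * p x)) := by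
  rw [hp.map_smul, norm_smul, mul_pow, Real.norm_eq_abs, sq_abs]
  ring

theorem contDiff_norm_gradient_sq {f : Euc n → ℝ} (hf : ContDiff ℝ ∞ f) :
    ContDiff ℝ ∞ fun x => ‖gradient f x‖ ^ 2 :=
  ((InnerProductSpace.toDual ℝ (Euc n)).symm.contDiff.comp
    (hf.fderiv_right (m := ∞) (by simp))).norm_sq ℝ

theorem IsSolidHarmonic.norm_gradient_sq_homogeneous (hp : IsSolidHarmonic p k)
    (c : ℝ) (x : Euc n) :
    c ^ 2 * ‖gradient p (c • x)‖ ^ 2 = c ^ (2 * k) * ‖gradient p x‖ ^ 2 := by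
  have h1 : c • gradient p (c • x) = c ^ k • gradient p x := by
    refine ext_inner_right ℝ fun v => ?_
    rw [inner_smul_left, inner_smul_left, inner_gradient_eq_fderiv, inner_gradient_eq_fderiv]
    have hd := hp.contDiff.differentiable (by simp)
    have e1 : HasFDerivAt (fun y : Euc n => p (c • y))
        ((fderiv ℝ p (c • x)).comp (c • ContinuousLinearMap.id ℝ (Euc n))) x :=
      (hd (c • x)).hasFDerivAt.comp x ((hasFDerivAt_id x).const_smul c)
    have e2 : HasFDerivAt (fun y : Euc n => c ^ k * p y) (c ^ k • fderiv ℝ p x) x :=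
      (hd x).hasFDerivAt.const_mul _
    simp only [hp.map_smul] at e1
    have := congrArg (fun L => L v) (e1.unique e2)
    simpa using this
  have h2 := congrArg (fun y => ‖y‖ ^ 2) h1
  simp only [norm_smul, mul_pow, Real.norm_eq_abs, sq_abs] at h2
  rwa [pow_mul']

theorem IsSolidHarmonic.integral_sphere_sq [Nontrivial (Euc n)] (hp : IsSolidHarmonic p k) (i : ℕ) :
    ∫ θ : Metric.sphere (0 : Euc n) 1, p θ * p θ ∂sphereMeasure n =
      (n + 2 * k + 2 * i) *
        ∫ x in Metric.ball (0 : Euc n) 1, (‖x‖ ^ 2) ^ i * (p x * p x) := by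
  have hc := hp.contDiff
  have h := integral_sphereMeasure_of_homogeneous
    (f := fun x : Euc n => (‖x‖ ^ 2) ^ i * (p x * p x))
    (((contDiff_norm_sq ℝ).pow i).mul (hc.mul hc)) (hp.sq_homogeneous i)
  simp only [norm_eq_of_mem_sphere, one_pow, one_mul] at h
  rw [h]
  push_cast
  ring

/-- Let `A` and `B` be the ball integrals of `‖∇p‖²` and `‖x‖² ‖∇p‖²`. Both integrands agree on the
sphere, so `(n + 2k - 2) A = (n + 2k) B`; the case `i = 0` of
`IsSolidHarmonic.integral_inner_gradient_ball` with `u = p` gives `B - A = -2k ∫ p²`. Eliminating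
`B` leaves the claim. -/
theorem IsSolidHarmonic.integral_norm_gradient_sq [Nontrivial (Euc n)] (hn : 2 ≤ n)
    (hp : IsSolidHarmonic p k) :
    ∫ x in Metric.ball (0 : Euc n) 1, ‖gradient p x‖ ^ 2 =
      k * (n + 2 * k) * ∫ x in Metric.ball (0 : Euc n) 1, p x * p x := by
  have hgc := contDiff_norm_gradient_sq hp.contDiff
  have h1 := integral_sphereMeasure_of_homogeneous hgc hp.norm_gradient_sq_homogeneous
  have h2 := integral_sphereMeasure_of_homogeneous (d := 2 * k + 2) (e := 2)
    (f := fun x : Euc n => ‖x‖ ^ 2 * ‖gradient p x‖ ^ 2) ((contDiff_norm_sq ℝ).mul hgc)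
    (fun c x => by
      have := hp.norm_gradient_sq_homogeneous c x
      simp only [norm_smul, mul_pow, Real.norm_eq_abs, sq_abs]
      linear_combination c ^ 2 * ‖x‖ ^ 2 * this)
  simp only [norm_eq_of_mem_sphere, one_pow, one_mul] at h2
  have h3 := hp.integral_inner_gradient_ball
    (hasWeakGradient_gradient Metric.isBounded_ball hp.contDiff) 0
  simp only [zero_add, pow_one, pow_zero, one_mul, real_inner_self_eq_norm_sq, sub_mul] at h3
  rw [integral_sub (integrableOn_of_continuous Metric.isBounded_ball (by
      have := hgc.continuous; fun_prop))
    (integrableOn_of_continuous Metric.isBounded_ball hgc.continuous)] at h3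
  rw [h1] at h2
  push_cast at h2 h3
  set A := ∫ x in Metric.ball (0 : Euc n) 1, ‖gradient p x‖ ^ 2
  set B := ∫ x in Metric.ball (0 : Euc n) 1, ‖x‖ ^ 2 * ‖gradient p x‖ ^ 2
  have hn' : (2 : ℝ) ≤ n := by exact_mod_cast hn
  have hk : (0 : ℝ) ≤ k := Nat.cast_nonneg k
  linear_combination (-1 / 2 : ℝ) * h2 - (1 / 2) * (n + 2 * k) * h3

end Homogeneous

/-! ### Vanishing radial moments and Weierstrass approximation -/

section Moments

variable {n : ℕ}

/-- An integrable function on the unit ball that is orthogonal to all powers of `‖x‖²` has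
integral zero over every centred ball; here the one of radius `1 / 2`. -/
theorem setIntegral_ball_half_eq_zero_of_moments {f : Euc n → ℝ}
    (hf : IntegrableOn f (Metric.ball 0 1))
    (h : ∀ i : ℕ, ∫ x in Metric.ball (0 : Euc n) 1, (‖x‖ ^ 2) ^ i * f x = 0) :
    ∫ x in Metric.ball (0 : Euc n) (1 / 2), f x = 0 := by
  have hpoly : ∀ q : Polynomial ℝ,
      ∫ x in Metric.ball (0 : Euc n) 1, q.eval (‖x‖ ^ 2) * f x = 0 := by
    intro q
    simp only [Polynomial.eval_eq_sum_range, Finset.sum_mul, mul_assoc]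
    rw [integral_finsetSum _ fun i _ =>
      (integrableOn_radial_mul (b := fun s => s ^ i) hf (by fun_prop)).const_mul _]
    refine Finset.sum_eq_zero fun i _ => ?_
    rw [integral_const_mul, h i, mul_zero]
  have hcont : ∀ b : ℝ → ℝ, Continuous b →
      ∫ x in Metric.ball (0 : Euc n) 1, b (‖x‖ ^ 2) * f x = 0 := by
    intro b hb
    set K := ∫ x in Metric.ball (0 : Euc n) 1, |f x|
    have hK : 0 ≤ K := integral_nonneg fun x => abs_nonneg _
    have hle : ∀ ε : ℝ, 0 < ε → |∫ x in Metric.ball (0 : Euc n) 1, b (‖x‖ ^ 2) * f x| ≤ ε * K := by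
      intro ε hε
      obtain ⟨q, hq⟩ := exists_polynomial_near_of_continuousOn 0 1 b hb.continuousOn ε hε
      rw [← sub_zero (∫ x in Metric.ball (0 : Euc n) 1, b (‖x‖ ^ 2) * f x), ← hpoly q,
        ← integral_sub (integrableOn_radial_mul hf hb) (integrableOn_radial_mul hf q.continuous),
        ← integral_const_mul]
      rw [← Real.norm_eq_abs]
      refine norm_integral_le_of_norm_le (hf.abs.const_mul _) ?_
      refine (ae_restrict_iff' measurableSet_ball).2 (Filter.Eventually.of_forall fun x hx => ?_)
      rw [mem_ball_zero_iff] at hx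
      rw [← sub_mul, norm_mul, Real.norm_eq_abs, Real.norm_eq_abs, abs_sub_comm]
      exact mul_le_mul_of_nonneg_right
        (hq _ ⟨by positivity, by nlinarith [norm_nonneg x]⟩).le (abs_nonneg _)
    by_contra hne
    have hpos := abs_pos.2 hne
    have := hle (|∫ x in Metric.ball (0 : Euc n) 1, b (‖x‖ ^ 2) * f x| / (2 * (K + 1)))
      (by positivity)
    rw [div_mul_eq_mul_div, le_div_iff₀ (by positivity)] at this
    nlinarith
  -- Continuous functions increasing to the indicator of `s < 1 / 4`, that is, of `‖x‖ < 1 / 2` when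
  -- `s = ‖x‖²`.
  set b : ℕ → ℝ → ℝ := fun l s => max 0 (min 1 (l * (1 / 4 - s)))
  have hb : ∀ l, Continuous (b l) := fun l => by fun_prop
  have hlim := tendsto_integral_of_dominated_convergence
    (μ := volume.restrict (Metric.ball (0 : Euc n) 1))
    (F := fun (l : ℕ) x => b l (‖x‖ ^ 2) * f x)
    (f := (Metric.ball (0 : Euc n) (1 / 2)).indicator f) (fun x => |f x|)
    (fun l => (integrableOn_radial_mul hf (hb l)).aestronglyMeasurable) hf.abs
    (fun l => Filter.Eventually.of_forall fun x => ?_) (Filter.Eventually.of_forall fun x => ?_)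
  · simp only [hcont _ (hb _)] at hlim
    rw [← tendsto_nhds_unique tendsto_const_nhds hlim |>.symm,
      setIntegral_indicator measurableSet_ball,
      Set.inter_eq_right.2 (Metric.ball_subset_ball (by norm_num))]
  · rw [norm_mul]
    refine mul_le_of_le_one_left (abs_nonneg _) ?_
    rw [Real.norm_eq_abs, abs_of_nonneg (le_max_left _ _)]
    exact max_le zero_le_one (min_le_left _ _)
  · by_cases hx : ‖x‖ < 1 / 2
    · rw [Set.indicator_of_mem (by simpa using hx)]
      have hs : 0 < 1 / 4 - ‖x‖ ^ 2 := by nlinarith [norm_nonneg x]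
      refine tendsto_const_nhds.congr' ?_
      obtain ⟨N, hN⟩ := exists_nat_gt (1 / (1 / 4 - ‖x‖ ^ 2))
      filter_upwards [Filter.eventually_ge_atTop N] with l hl
      have hl' : (N : ℝ) ≤ l := by exact_mod_cast hl
      rw [div_lt_iff₀ hs] at hN
      have : 1 ≤ (l : ℝ) * (1 / 4 - ‖x‖ ^ 2) := by nlinarith
      have hbl : b l (‖x‖ ^ 2) = 1 := by
        simp only [b, min_eq_left this, max_eq_right zero_le_one]
      rw [hbl, one_mul]
    · rw [Set.indicator_of_notMem (by simpa using hx)]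
      refine tendsto_const_nhds.congr fun l => ?_
      have : (l : ℝ) * (1 / 4 - ‖x‖ ^ 2) ≤ 0 :=
        mul_nonpos_of_nonneg_of_nonpos (Nat.cast_nonneg l) (by nlinarith)
      have hbl : b l (‖x‖ ^ 2) = 0 := max_eq_left ((min_le_right _ _).trans this)
      rw [hbl, zero_mul]

end Moments

/-! ### Cauchy-Schwarz and limits of pairings -/

section CauchySchwarz

variable {α F : Type*} [MeasurableSpace α] {μ : Measure α} [NormedAddCommGroup F]
  [InnerProductSpace ℝ F]

theorem abs_integral_inner_le {f g : α → F} (hf : MemLp f 2 μ) (hg : MemLp g 2 μ) :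
    |∫ x, inner ℝ (f x) (g x) ∂μ| ≤ (eLpNorm f 2 μ).toReal * (eLpNorm g 2 μ).toReal := by
  have h : ∫ x, inner ℝ (f x) (g x) ∂μ = inner ℝ (hf.toLp f) (hg.toLp g) := by
    rw [L2.inner_def]
    refine integral_congr_ae ?_
    filter_upwards [hf.coeFn_toLp, hg.coeFn_toLp] with x h1 h2
    rw [h1, h2]
  rw [h, ← Lp.norm_toLp f hf, ← Lp.norm_toLp g hg]
  exact abs_real_inner_le_norm _ _

theorem tendsto_integral_inner {f : ℕ → α → F} {g : α → F} (hf : ∀ l, MemLp (f l) 2 μ)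
    (hg : MemLp g 2 μ) (h : Filter.Tendsto (fun l => eLpNorm (f l) 2 μ) Filter.atTop (𝓝 0)) :
    Filter.Tendsto (fun l => ∫ x, inner ℝ (f l x) (g x) ∂μ) Filter.atTop (𝓝 0) := by
  have h1 : Filter.Tendsto (fun l => (eLpNorm (f l) 2 μ).toReal * (eLpNorm g 2 μ).toReal)
      Filter.atTop (𝓝 0) := by
    simpa using (((ENNReal.tendsto_toReal ENNReal.zero_ne_top).comp h).mul_const _)
  exact squeeze_zero_norm (fun l => abs_integral_inner_le (hf l) hg) h1

theorem abs_integral_mul_le {f g : α → ℝ} (hf : MemLp f 2 μ) (hg : MemLp g 2 μ) :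
    |∫ x, f x * g x ∂μ| ≤ (eLpNorm f 2 μ).toReal * (eLpNorm g 2 μ).toReal := by
  simpa [mul_comm] using abs_integral_inner_le hf hg

theorem tendsto_integral_mul {f : ℕ → α → ℝ} {g : α → ℝ} (hf : ∀ l, MemLp (f l) 2 μ)
    (hg : MemLp g 2 μ) (h : Filter.Tendsto (fun l => eLpNorm (f l) 2 μ) Filter.atTop (𝓝 0)) :
    Filter.Tendsto (fun l => ∫ x, f l x * g x ∂μ) Filter.atTop (𝓝 0) := by
  simpa [mul_comm] using tendsto_integral_inner hf hg h

end CauchySchwarz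

/-! ### Pairing the trace with a solid harmonic -/

section Trace

variable {n : ℕ} {p : Euc n → ℝ} {k : ℕ}

instance : IsFiniteMeasure (sphereMeasure n) := by
  unfold sphereMeasure
  infer_instance

theorem memLp_sphere_of_continuous {f : Euc n → ℝ} (hf : Continuous f) (q : ℝ≥0∞) :
    MemLp (fun θ : Metric.sphere (0 : Euc n) 1 => f θ) q (sphereMeasure n) := by
  have hc : Continuous fun θ : Metric.sphere (0 : Euc n) 1 => f θ := hf.comp continuous_subtype_val
  obtain ⟨C, hC⟩ := isCompact_univ.exists_bound_of_continuousOn hc.continuousOn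
  exact MemLp.of_bound hc.aestronglyMeasurable C
    (Filter.Eventually.of_forall fun θ => hC θ (Set.mem_univ θ))

theorem eLpNorm_le_h1Norm {D : Set (Euc n)} (hD : IsOpen D) {u : Euc n → ℝ} {G : Euc n → Euc n}
    (hG : HasWeakGradient D u G) : eLpNorm u 2 (volume.restrict D) ≤ h1Norm D u ∧
      eLpNorm G 2 (volume.restrict D) ≤ h1Norm D u := by
  have h : ∀ a : ℝ≥0∞, a = (a ^ 2) ^ (1 / 2 : ℝ) := fun a => by
    rw [← ENNReal.rpow_natCast, ← ENNReal.rpow_mul]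
    norm_num
  rw [h1Norm_eq hD hG]
  constructor
  · conv_lhs => rw [h (eLpNorm u 2 _)]
    exact ENNReal.rpow_le_rpow le_self_add (by norm_num)
  · conv_lhs => rw [h (eLpNorm G 2 _)]
    exact ENNReal.rpow_le_rpow le_add_self (by norm_num)

/-- Pairing the trace of a weakly harmonic function with a solid harmonic on the unit sphere. -/
theorem IsSolidHarmonic.integral_trace [Nontrivial (Euc n)] (hp : IsSolidHarmonic p k)
    {u : Euc n → ℝ} {G : Euc n → Euc n} (hu : HasWeakGradient (Metric.ball 0 1) u G)
    (hG : ∀ φ, IsTestFunction (Metric.ball 0 1) φ →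
      ∫ x in Metric.ball (0 : Euc n) 1, inner ℝ (G x) (gradient φ x) = 0)
    {g : Metric.sphere (0 : Euc n) 1 → ℝ} (hg : IsTrace u g) (i : ℕ) :
    ∫ θ, g θ * p θ ∂sphereMeasure n =
      (n + 2 * k + 2 * i) * ∫ x in Metric.ball (0 : Euc n) 1, (‖x‖ ^ 2) ^ i * (u x * p x) := by
  obtain ⟨hg2, φ, hφ, hφu, hφg⟩ := hg
  have hpc := hp.contDiff
  have hpc' := hpc.continuous
  have hw : ∀ l, HasWeakGradient (Metric.ball 0 1) (fun x => φ l x - u x)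
      (fun x => gradient (φ l) x - G x) := fun l =>
    (hasWeakGradient_gradient Metric.isBounded_ball (hφ l)).sub hu
  have t1 : Filter.Tendsto (fun l => eLpNorm (fun x => φ l x - u x) 2
      (volume.restrict (Metric.ball (0 : Euc n) 1))) Filter.atTop (𝓝 0) :=
    tendsto_of_tendsto_of_tendsto_of_le_of_le tendsto_const_nhds hφu (fun _ => zero_le)
      fun l => (eLpNorm_le_h1Norm Metric.isOpen_ball (hw l)).1
  have t2 : Filter.Tendsto (fun l => eLpNorm (fun x => gradient (φ l) x - G x) 2
      (volume.restrict (Metric.ball (0 : Euc n) 1))) Filter.atTop (𝓝 0) :=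
    tendsto_of_tendsto_of_tendsto_of_le_of_le tendsto_const_nhds hφu (fun _ => zero_le)
      fun l => (eLpNorm_le_h1Norm Metric.isOpen_ball (hw l)).2
  -- An extension of `p` from the sphere to the ball; varying `i` yields all radial moments from one
  -- boundary integral.
  set w : Euc n → ℝ := fun x => (‖x‖ ^ 2) ^ i * p x with hw_def
  have hwc : ContDiff ℝ ∞ w := ((contDiff_norm_sq ℝ).pow i).mul hpc
  have hwc' := hwc.continuous
  have hwE : ∀ x, fderiv ℝ w x x = (k + 2 * i) * w x := fun x => by
    have := fderiv_self_of_homogeneous (d := k + 2 * i) (e := 0) (hwc.differentiable (by simp))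
      (fun c x => by
        simp only [hw_def, hp.map_smul, norm_smul, mul_pow, Real.norm_eq_abs, sq_abs]
        ring) x
    rw [this]
    push_cast
    ring
  have hwS : ∀ θ : Metric.sphere (0 : Euc n) 1, w θ = p θ := fun θ => by
    simp only [hw_def, norm_eq_of_mem_sphere, one_pow, one_mul]
  have m1 : MemLp w 2 (volume.restrict (Metric.ball (0 : Euc n) 1)) :=
    memLp_restrict_of_continuous Metric.isBounded_ball hwc' 2
  have m2 : MemLp (fun x => w x • x) 2 (volume.restrict (Metric.ball (0 : Euc n) 1)) :=
    memLp_restrict_of_continuous Metric.isBounded_ball (by fun_prop) 2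
  have mp : MemLp (fun θ : Metric.sphere (0 : Euc n) 1 => p θ) 2 (sphereMeasure n) :=
    memLp_sphere_of_continuous hpc' 2
  have c1 := tendsto_integral_mul (fun l => (hw l).memLp) m1 t1
  have c2 := tendsto_integral_inner (fun l => (hw l).memLp_grad) m2 t2
  have c3 := tendsto_integral_mul
    (fun l => (memLp_sphere_of_continuous (hφ l).continuous 2).sub hg2) mp hφg
  have iu := hu.integrableOn_mul hwc'
  have iG := hu.integrableOn_inner (V := fun x => w x • x) (by fun_prop)
  -- The divergence theorem for the smooth product `φ l * w`, arranged as error terms tending to `0`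
  -- plus a constant independent of `l`. In the limit that constant must be zero.
  have key : ∀ l, ∫ θ, (φ l θ - g θ) * p θ ∂sphereMeasure n =
      (n + k + 2 * i) * (∫ x in Metric.ball (0 : Euc n) 1, (φ l x - u x) * w x) +
      (∫ x in Metric.ball (0 : Euc n) 1, inner ℝ (gradient (φ l) x - G x) (w x • x)) +
      ((n + k + 2 * i) * (∫ x in Metric.ball (0 : Euc n) 1, u x * w x) +
        (∫ x in Metric.ball (0 : Euc n) 1, inner ℝ (G x) (w x • x)) -
        ∫ θ, g θ * p θ ∂sphereMeasure n) := by
    intro l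
    have s := integral_sphereMeasure ((hφ l).mul hwc)
    have s' : ∀ x, n * (φ l x * w x) + fderiv ℝ (fun x => φ l x * w x) x x =
        (n + k + 2 * i) * (φ l x * w x) + inner ℝ (gradient (φ l) x) (w x • x) := by
      intro x
      rw [fderiv_fun_mul ((hφ l).differentiable (by simp) x) (hwc.differentiable (by simp) x),
        inner_smul_right, inner_gradient_eq_fderiv]
      simp [hwE]
      ring
    simp only [s'] at s
    have ip : IntegrableOn (fun x => φ l x * w x) (Metric.ball 0 1) :=
      integrableOn_of_continuous Metric.isBounded_ball ((hφ l).continuous.mul hwc')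
    have ig : IntegrableOn (fun x => inner ℝ (gradient (φ l) x) (w x • x)) (Metric.ball 0 1) := by
      refine integrableOn_of_continuous Metric.isBounded_ball ?_
      have := continuous_gradient (hφ l)
      fun_prop
    rw [integral_add (ip.const_mul _) ig, integral_const_mul] at s
    simp only [hwS] at s
    simp only [sub_mul, inner_sub_left]
    rw [integral_sub (integrable_mul_of_memLp_two
      (memLp_sphere_of_continuous (hφ l).continuous 2) mp) (integrable_mul_of_memLp_two hg2 mp),
      integral_sub ip iu, integral_sub ig iG, s]
    ring
  simp only [Pi.sub_apply, key] at c3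
  have c4 := ((c1.const_mul ((n : ℝ) + k + 2 * i)).add c2).add_const
    ((n + k + 2 * i) * (∫ x in Metric.ball (0 : Euc n) 1, u x * w x) +
        (∫ x in Metric.ball (0 : Euc n) 1, inner ℝ (G x) (w x • x)) -
        ∫ θ, g θ * p θ ∂sphereMeasure n)
  have e := tendsto_nhds_unique c3 c4
  have e2 := hp.integral_radial_deriv hu hG i
  have e3 : ∫ x in Metric.ball (0 : Euc n) 1, inner ℝ (G x) (w x • x) =
      ∫ x in Metric.ball (0 : Euc n) 1, (‖x‖ ^ 2) ^ i * (inner ℝ (G x) x * p x) := by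
    congr 1 with x
    rw [inner_smul_right]
    ring
  have e4 : ∫ x in Metric.ball (0 : Euc n) 1, u x * w x =
      ∫ x in Metric.ball (0 : Euc n) 1, (‖x‖ ^ 2) ^ i * (u x * p x) := by
    congr 1 with x
    ring
  rw [e3, e4, e2] at e
  linarith

/-- The radial moments determine the pairing with `p` on a smaller ball. -/
theorem IsSolidHarmonic.integral_half_ball_mul [Nontrivial (Euc n)] (hn : 0 < n)
    (hp : IsSolidHarmonic p k)
    {u : Euc n → ℝ} {G : Euc n → Euc n} (hu : HasWeakGradient (Metric.ball 0 1) u G)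
    (hG : ∀ φ, IsTestFunction (Metric.ball 0 1) φ →
      ∫ x in Metric.ball (0 : Euc n) 1, inner ℝ (G x) (gradient φ x) = 0)
    {g : Metric.sphere (0 : Euc n) 1 → ℝ} (hg : IsTrace u g) :
    (∫ θ : Metric.sphere (0 : Euc n) 1, p θ * p θ ∂sphereMeasure n) *
        ∫ x in Metric.ball (0 : Euc n) (1 / 2), u x * p x =
      (∫ θ, g θ * p θ ∂sphereMeasure n) *
        ∫ x in Metric.ball (0 : Euc n) (1 / 2), p x * p x := by
  set A := ∫ θ : Metric.sphere (0 : Euc n) 1, p θ * p θ ∂sphereMeasure n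
  set B := ∫ θ, g θ * p θ ∂sphereMeasure n
  have hpc := hp.contDiff.continuous
  have iu : IntegrableOn (fun x => u x * p x) (Metric.ball 0 1) := hu.integrableOn_mul hpc
  have ip : IntegrableOn (fun x => p x * p x) (Metric.ball 0 1) :=
    integrableOn_of_continuous Metric.isBounded_ball (hpc.mul hpc)
  have hsub : Metric.ball (0 : Euc n) (1 / 2) ⊆ Metric.ball 0 1 :=
    Metric.ball_subset_ball (by norm_num)
  -- The moments of `u p` and of `p²` are `B` and `A` divided by the same number `n + 2k + 2i`, so
  -- in this combination they cancel for every `i`.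
  have h := setIntegral_ball_half_eq_zero_of_moments
    (f := fun x => A * (u x * p x) - B * (p x * p x)) ((iu.const_mul A).sub (ip.const_mul B))
    (fun i => by
      have iu' := integrableOn_radial_mul (b := fun s => s ^ i) iu (by fun_prop)
      have ip' := integrableOn_radial_mul (b := fun s => s ^ i) ip (by fun_prop)
      have e1 := hp.integral_trace hu hG hg i
      have e2 := hp.integral_sphere_sq i
      have hpos : (0 : ℝ) < n + 2 * k + 2 * i := by positivity
      simp only [mul_sub, mul_left_comm _ A, mul_left_comm _ B]
      rw [integral_sub (iu'.const_mul A) (ip'.const_mul B), integral_const_mul, integral_const_mul]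
      refine mul_left_cancel₀ hpos.ne' ?_
      linear_combination (-A) * e1 + B * e2)
  rw [integral_sub ((iu.mono_set hsub).const_mul A) ((ip.mono_set hsub).const_mul B),
    integral_const_mul, integral_const_mul, sub_eq_zero] at h
  exact h

end Trace

/-! ### Existence and normalization of solid harmonics -/

section Construction

variable {n : ℕ}

/-- The constant `c` keeps the family closed under differentiation, so the formula can be iterated
for the Laplacian. -/
theorem fderiv_re_mul_pow (Z : Euc n →L[ℝ] ℂ) (c : ℂ) (k : ℕ) (x v : Euc n) :
    fderiv ℝ (fun x => (c * Z x ^ k).re) x v = (k * c * Z v * Z x ^ (k - 1)).re := by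
  have h : HasFDerivAt (fun x => (c * Z x ^ k).re)
      (Complex.reCLM.comp (c • ((k * Z x ^ (k - 1)) • Z))) x := by
    have h1 := HasFDerivAt.pow (Z.hasFDerivAt (x := x)) k
    have h2 := Complex.reCLM.hasFDerivAt.comp x (h1.const_mul c)
    refine h2.congr_fderiv ?_
    ext v
    simp
  rw [h.fderiv]
  simp only [ContinuousLinearMap.comp_apply, _root_.smul_apply, smul_eq_mul,
    Complex.reCLM_apply]
  congr 1
  ring

/-- The real part of the `k`-th power of a linear map to `ℂ` with isotropic coefficients is a solid
harmonic. -/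
theorem isSolidHarmonic_re_pow (Z : Euc n →L[ℝ] ℂ) (hZ : ∑ i, Z (basisVec i) ^ 2 = 0) (k : ℕ) :
    IsSolidHarmonic (fun x => (Z x ^ k).re) k where
  contDiff := Complex.reCLM.contDiff.comp (Z.contDiff.pow k)
  map_smul c x := by
    rw [map_smul, smul_pow, Complex.smul_re, smul_eq_mul]
  laplacian_eq_zero x := by
    have h1 : ∀ (i : Fin n) (y : Euc n), fderiv ℝ (fun x => (Z x ^ k).re) y (basisVec i) =
        (k * Z (basisVec i) * Z y ^ (k - 1)).re := fun i y => by
      simpa using fderiv_re_mul_pow Z 1 k y (basisVec i)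
    simp only [h1, fderiv_re_mul_pow]
    rw [← Complex.re_sum]
    have h2 : ∀ i : Fin n, ((k - 1 : ℕ) : ℂ) * (k * Z (basisVec i)) * Z (basisVec i) *
        Z x ^ (k - 1 - 1) = ((k - 1 : ℕ) : ℂ) * k * Z x ^ (k - 1 - 1) * Z (basisVec i) ^ 2 :=
      fun i => by ring
    simp only [h2]
    rw [← Finset.mul_sum, hZ, mul_zero, Complex.zero_re]

/-- The witness is `Re (x₀ + i x₁) ^ k`, isotropic because `1 + i² = 0`, with value `1` at the first
basis vector. Two coordinates are needed, hence `2 ≤ n`. -/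
theorem exists_isSolidHarmonic (hn : 2 ≤ n) (k : ℕ) :
    ∃ p : Euc n → ℝ, IsSolidHarmonic p k ∧ ∃ x, p x ≠ 0 := by
  set i₀ : Fin n := ⟨0, by omega⟩
  set i₁ : Fin n := ⟨1, by omega⟩
  have hne : i₀ ≠ i₁ := by simp [i₀, i₁]
  set Z : Euc n →L[ℝ] ℂ := Complex.ofRealCLM.comp (EuclideanSpace.proj i₀) +
    Complex.I • Complex.ofRealCLM.comp (EuclideanSpace.proj i₁)
  have hZ : ∀ x : Euc n, Z x = (x i₀ : ℂ) + Complex.I * (x i₁ : ℂ) := fun x => by simp [Z]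
  refine ⟨_, isSolidHarmonic_re_pow Z ?_ k, basisVec i₀, ?_⟩
  · have h : ∀ i : Fin n, Z (basisVec i) ^ 2 =
        (if i = i₀ then (1 : ℂ) else 0) - (if i = i₁ then (1 : ℂ) else 0) := by
      intro i
      rw [hZ]
      by_cases h0 : i = i₀
      · subst h0
        simp [hne, hne.symm]
      · by_cases h1 : i = i₁
        · subst h1
          simp [hne, hne.symm]
        · simp [h0, h1, Ne.symm h0, Ne.symm h1]
    simp [h]
  · rw [hZ]
    simp [hne.symm]

theorem IsSolidHarmonic.const_mul {p : Euc n → ℝ} {k : ℕ} (hp : IsSolidHarmonic p k) (c : ℝ) :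
    IsSolidHarmonic (fun x => c * p x) k where
  contDiff := contDiff_const.mul hp.contDiff
  map_smul a x := by
    rw [hp.map_smul]
    ring
  laplacian_eq_zero x := by
    have h1 : ∀ (f : Euc n → ℝ), ContDiff ℝ ∞ f → ∀ y v, fderiv ℝ (fun x => c * f x) y v =
        c * fderiv ℝ f y v := fun f hf y v => by
      rw [fderiv_const_mul (hf.differentiable (by simp) y)]
      simp
    simp only [h1 p hp.contDiff, h1 _ (contDiff_fderiv_apply hp.contDiff _)]
    rw [← Finset.mul_sum, hp.laplacian_eq_zero, mul_zero]

theorem IsSolidHarmonic.integral_sq_pos {p : Euc n → ℝ} {k : ℕ} (hp : IsSolidHarmonic p k)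
    {y : Euc n} (hy : p y ≠ 0) : 0 < ∫ x in Metric.ball (0 : Euc n) 1, p x * p x := by
  have hc := hp.contDiff.continuous
  rw [setIntegral_pos_iff_support_of_nonneg_ae
    (Filter.Eventually.of_forall fun x => mul_self_nonneg _)
    (integrableOn_of_continuous Metric.isBounded_ball (hc.mul hc))]
  refine (((hc.mul hc).isOpen_support).inter Metric.isOpen_ball).measure_pos volume
    -- Homogeneity moves the nonvanishing point into the unit ball.
    ⟨(1 / (‖y‖ + 1)) • y, ?_, ?_⟩
  · rw [Function.mem_support, Pi.mul_apply, hp.map_smul]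
    have : (1 / (‖y‖ + 1)) ≠ 0 := by positivity
    positivity
  · rw [mem_ball_zero_iff, norm_smul, Real.norm_of_nonneg (by positivity), one_div,
      inv_mul_lt_iff₀ (by positivity)]
    linarith

theorem IsSolidHarmonic.setIntegral_half_ball_sq {p : Euc n → ℝ} {k : ℕ}
    (hp : IsSolidHarmonic p k) : ∫ x in Metric.ball (0 : Euc n) (1 / 2), p x * p x =
      (1 / 2) ^ (n + 2 * k) * ∫ x in Metric.ball (0 : Euc n) 1, p x * p x := by
  have h := setIntegral_ball_half_of_homogeneous (f := fun x : Euc n => p x * p x) (d := 2 * k)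
    (e := 0) (fun c x => by
      rw [hp.map_smul]
      ring)
  rwa [pow_zero, one_mul] at h

/-- The ratio of the squared `H¹` and `L²` norms on the half ball. -/
theorem IsSolidHarmonic.half_ball_integrals [Nontrivial (Euc n)] (hn : 2 ≤ n) {p : Euc n → ℝ}
    {k : ℕ} (hp : IsSolidHarmonic p k) :
    ∫ x in Metric.ball (0 : Euc n) (1 / 2), ‖gradient p x‖ ^ 2 =
      4 * k * (n + 2 * k) * ∫ x in Metric.ball (0 : Euc n) (1 / 2), p x * p x := by
  have h1 := setIntegral_ball_half_of_homogeneous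
    (f := fun x : Euc n => ‖gradient p x‖ ^ 2) hp.norm_gradient_sq_homogeneous
  have h2 := hp.setIntegral_half_ball_sq
  have h3 := hp.integral_norm_gradient_sq hn
  rw [h3] at h1
  rw [h2]
  linear_combination 4 * h1

/-- By `IsSolidHarmonic.half_ball_integrals`, the squared `H¹` norm on the half ball is `1 + 4k(n +
2k)` times the squared `L²` norm; this value is thus the one that makes the `H¹` norm equal to `1`.
-/
theorem exists_normalized_solidHarmonic [Nontrivial (Euc n)] (hn : 2 ≤ n) (k : ℕ) :
    ∃ p : Euc n → ℝ, IsSolidHarmonic p k ∧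
      ∫ x in Metric.ball (0 : Euc n) (1 / 2), p x * p x = (1 + 4 * k * (n + 2 * k) : ℝ)⁻¹ := by
  obtain ⟨p, hp, y, hy⟩ := exists_isSolidHarmonic hn k
  have hpos := hp.integral_sq_pos hy
  have h2 := hp.setIntegral_half_ball_sq
  set J := ∫ x in Metric.ball (0 : Euc n) (1 / 2), p x * p x with hJ
  have hJpos : 0 < J := by rw [h2]; positivity
  set c := Real.sqrt ((1 + 4 * k * (n + 2 * k) : ℝ)⁻¹ / J)
  have hc : c * c = (1 + 4 * k * (n + 2 * k) : ℝ)⁻¹ / J := Real.mul_self_sqrt (by positivity)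
  refine ⟨fun x => c * p x, hp.const_mul c, ?_⟩
  simp only [fun x => mul_mul_mul_comm c (p x) c (p x)]
  rw [integral_const_mul, hc, ← hJ, div_mul_cancel₀ _ hJpos.ne']

end Construction

/-! ### Norm estimates and the lower bound for the trace -/

section Norms

theorem eLpNorm_two_sq {α F : Type*} [MeasurableSpace α] {μ : Measure α} [NormedAddCommGroup F]
    {f : α → F} (hf : MemLp f 2 μ) :
    eLpNorm f 2 μ ^ 2 = ENNReal.ofReal (∫ x, ‖f x‖ ^ 2 ∂μ) := by
  rw [hf.eLpNorm_eq_integral_rpow_norm (by norm_num) (by norm_num),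
    ← ENNReal.ofReal_pow (by positivity)]
  congr 1
  simp only [ENNReal.toReal_ofNat, Real.rpow_ofNat]
  rw [← Real.rpow_natCast, ← Real.rpow_mul (integral_nonneg fun x => by positivity)]
  norm_num

variable {n : ℕ}

theorem IsSolidHarmonic.mem_harmonicH1 {p : Euc n → ℝ} {k : ℕ} (hp : IsSolidHarmonic p k)
    {D : Set (Euc n)} (hD : Bornology.IsBounded D) : p ∈ harmonicH1 D :=
  ⟨gradient p, hasWeakGradient_gradient hD hp.contDiff, fun _ hφ => hp.integral_inner_gradient hφ⟩

theorem IsSolidHarmonic.h1Norm_half_ball [Nontrivial (Euc n)] (hn : 2 ≤ n) {p : Euc n → ℝ} {k : ℕ}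
    (hp : IsSolidHarmonic p k)
    (h : ∫ x in Metric.ball (0 : Euc n) (1 / 2), p x * p x = (1 + 4 * k * (n + 2 * k) : ℝ)⁻¹) :
    h1Norm (Metric.ball 0 (1 / 2)) p = 1 := by
  have hw := hasWeakGradient_gradient (D := Metric.ball (0 : Euc n) (1 / 2))
    Metric.isBounded_ball hp.contDiff
  have hg := hp.half_ball_integrals hn
  rw [h] at hg
  have hs : ∀ x : Euc n, ‖p x‖ ^ 2 = p x * p x := fun x => by
    rw [Real.norm_eq_abs, sq_abs, sq]
  rw [h1Norm_eq Metric.isOpen_ball hw, eLpNorm_two_sq hw.memLp, eLpNorm_two_sq hw.memLp_grad, hg]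
  simp only [hs]
  rw [h, ← ENNReal.ofReal_add (by positivity) (by positivity)]
  have : (1 + 4 * k * (n + 2 * k) : ℝ)⁻¹ + 4 * k * (n + 2 * k) * (1 + 4 * k * (n + 2 * k) : ℝ)⁻¹ =
      1 := by
    have : (1 + 4 * k * (n + 2 * k) : ℝ) ≠ 0 := by positivity
    field_simp
  rw [this]
  simp

theorem eLpNorm_le_hHalfNorm (g : Metric.sphere (0 : Euc n) 1 → ℝ) :
    eLpNorm g 2 (sphereMeasure n) ≤ hHalfNorm g := by
  rw [eLpNorm_eq_lintegral_rpow_enorm_toReal (by norm_num) (by norm_num), hHalfNorm]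
  simp only [ENNReal.toReal_ofNat, ENNReal.rpow_ofNat]
  exact ENNReal.rpow_le_rpow le_self_add (by norm_num)

/-- A weakly harmonic function on the unit ball close to a solid harmonic of degree `k` on the half
ball has a large trace. -/
theorem IsSolidHarmonic.le_eLpNorm_trace [Nontrivial (Euc n)] (hn : 0 < n) {p : Euc n → ℝ} {k : ℕ}
    (hp : IsSolidHarmonic p k) {a δ : ℝ} (ha : 0 < a) (hδ : 0 ≤ δ)
    (h : ∫ x in Metric.ball (0 : Euc n) (1 / 2), p x * p x = a ^ 2)
    {u : Euc n → ℝ} (hu : u ∈ harmonicH1 (Metric.ball 0 1))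
    (hpu : eLpNorm (fun x => p x - u x) 2 (volume.restrict (Metric.ball 0 (1 / 2))) ≤
      ENNReal.ofReal δ)
    {g : Metric.sphere (0 : Euc n) 1 → ℝ} (hg : IsTrace u g) :
    2 ^ k * (a - δ) ≤ (eLpNorm g 2 (sphereMeasure n)).toReal := by
  obtain ⟨G, hw, hG⟩ := hu
  have hpc := hp.contDiff.continuous
  have hsub : Metric.ball (0 : Euc n) (1 / 2) ⊆ Metric.ball 0 1 :=
    Metric.ball_subset_ball (by norm_num)
  have key := hp.integral_half_ball_mul hn hw hG hg
  have hA := hp.integral_sphere_sq 0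
  have hh := hp.setIntegral_half_ball_sq
  simp only [pow_zero, one_mul, mul_zero, add_zero, Nat.cast_zero] at hA
  rw [h] at hh key
  have mp : MemLp p 2 (volume.restrict (Metric.ball (0 : Euc n) (1 / 2))) :=
    memLp_restrict_of_continuous Metric.isBounded_ball hpc 2
  have mu : MemLp u 2 (volume.restrict (Metric.ball (0 : Euc n) (1 / 2))) :=
    hw.memLp.mono_measure (Measure.restrict_mono hsub le_rfl)
  have ms : MemLp (fun θ : Metric.sphere (0 : Euc n) 1 => p θ) 2 (sphereMeasure n) :=
    memLp_sphere_of_continuous hpc 2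
  have hnorm : ∀ {α : Type} [MeasurableSpace α] {μ : Measure α} {f : α → ℝ} {b : ℝ},
      MemLp f 2 μ → 0 ≤ b → ∫ x, f x * f x ∂μ = b ^ 2 → (eLpNorm f 2 μ).toReal = b := by
    intro α _ μ f b hf hb hfb
    have e := congrArg ENNReal.toReal (eLpNorm_two_sq hf)
    have hs : ∀ x, ‖f x‖ ^ 2 = f x * f x := fun x => by rw [Real.norm_eq_abs, sq_abs, sq]
    simp only [hs, hfb] at e
    rw [ENNReal.toReal_pow, ENNReal.toReal_ofReal (by positivity)] at e
    exact (pow_left_inj₀ ENNReal.toReal_nonneg hb two_ne_zero).1 e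
  set A := ∫ θ : Metric.sphere (0 : Euc n) 1, p θ * p θ ∂sphereMeasure n with hAdef
  set B := ∫ θ, g θ * p θ ∂sphereMeasure n
  set U := ∫ x in Metric.ball (0 : Euc n) (1 / 2), u x * p x
  have hn1 : (1 : ℝ) ≤ n := by exact_mod_cast hn
  -- This is where the exponential gain arises: in fact `A = (n + 2k) * 2 ^ (n + 2k) * a ^ 2`, by
  -- homogeneity.
  have hAge : (2 ^ k * a) ^ 2 ≤ A := by
    have e1 : ∫ x in Metric.ball (0 : Euc n) 1, p x * p x = 2 ^ (n + 2 * k) * a ^ 2 := by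
      rw [hh, ← mul_assoc, ← mul_pow]
      norm_num
    have e2 : ((2 : ℝ) ^ k) ^ 2 ≤ 2 ^ (n + 2 * k) := by
      rw [← pow_mul]
      exact pow_le_pow_right₀ (by norm_num) (by omega)
    have e3 : (1 : ℝ) ≤ n + 2 * k := by
      have : (0 : ℝ) ≤ k := Nat.cast_nonneg k
      linarith
    rw [hA, e1, mul_pow]
    calc ((2 : ℝ) ^ k) ^ 2 * a ^ 2 ≤ 2 ^ (n + 2 * k) * a ^ 2 :=
          mul_le_mul_of_nonneg_right e2 (by positivity)
      _ ≤ (n + 2 * k) * (2 ^ (n + 2 * k) * a ^ 2) := le_mul_of_one_le_left (by positivity) e3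
  have hApos : 0 < A := lt_of_lt_of_le (by positivity) hAge
  have hsA : 2 ^ k * a ≤ Real.sqrt A := Real.le_sqrt_of_sq_le hAge
  have hsA2 : Real.sqrt A ^ 2 = A := Real.sq_sqrt hApos.le
  have hB : |B| ≤ (eLpNorm g 2 (sphereMeasure n)).toReal * Real.sqrt A := by
    refine (abs_integral_mul_le hg.1 ms).trans_eq ?_
    rw [hnorm ms (Real.sqrt_nonneg A) (by rw [hsA2])]
  -- Closeness on the half ball enters only through the pairing with `p`, by Cauchy-Schwarz.
  have hcl : a ^ 2 - U ≤ δ * a := by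
    have e1 : ∫ x in Metric.ball (0 : Euc n) (1 / 2), (p x - u x) * p x = a ^ 2 - U := by
      simp only [sub_mul]
      rw [integral_sub (integrable_mul_of_memLp_two mp mp) (integrable_mul_of_memLp_two mu mp), h]
    rw [← e1]
    refine (le_abs_self _).trans ((abs_integral_mul_le (mp.sub mu) mp).trans ?_)
    rw [hnorm mp ha.le h]
    refine mul_le_mul_of_nonneg_right ?_ ha.le
    exact ENNReal.toReal_le_of_le_ofReal hδ hpu
  set N := (eLpNorm g 2 (sphereMeasure n)).toReal
  have hN : 0 ≤ N := ENNReal.toReal_nonneg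
  by_cases hd : a - δ ≤ 0
  · exact (mul_nonpos_of_nonneg_of_nonpos (by positivity) hd).trans hN
  have hd := (not_le.1 hd).le
  -- The transfer identity reads `A * U = B * a ^ 2`; insert the lower bound for `U` and the upper
  -- bound for `B`, then cancel a factor `a`.
  have h1 : A * (a - δ) ≤ N * Real.sqrt A * a := by
    have h2 : A * (a * (a - δ)) ≤ A * U := mul_le_mul_of_nonneg_left (by nlinarith) hApos.le
    have h3 : B * a ^ 2 ≤ N * Real.sqrt A * a ^ 2 :=
      mul_le_mul_of_nonneg_right ((le_abs_self B).trans hB) (by positivity)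
    refine le_of_mul_le_mul_left ?_ ha
    nlinarith
  have hs : 0 < Real.sqrt A := Real.sqrt_pos.2 hApos
  have h2 : Real.sqrt A * (a - δ) ≤ N * a := by
    refine le_of_mul_le_mul_left ?_ hs
    nlinarith
  have h3 := mul_le_mul_of_nonneg_right hsA hd
  refine le_of_mul_le_mul_left ?_ ha
  nlinarith

end Norms

end Runge

/-! ### Choice of the degree and of the constant -/

theorem proposition4p1 (n : ℕ) (hn : 2 ≤ n) :
    ∃ c : ℝ, 0 < c ∧
    ∃ h : ℕ → EuclideanSpace ℝ (Fin n) → ℝ, ∀ j : ℕ, 1 ≤ j →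
      h j ∈ Runge.harmonicH1 (Metric.ball 0 (1 / 2)) ∧
      Runge.h1Norm (Metric.ball 0 (1 / 2)) (h j) = 1 ∧
      ∀ u ∈ Runge.harmonicH1Boundary (n := n) Set.univ,
        eLpNorm (fun x => h j x - u x) 2 (volume.restrict (Metric.ball 0 (1 / 2))) ≤
            ENNReal.ofReal ((10 * (j : ℝ))⁻¹) →
        ∀ g, Runge.IsTrace u g →
          ENNReal.ofReal (c * Real.exp (c * j)) ≤ Runge.hHalfNorm g := by
  have : Nonempty (Fin n) := ⟨⟨0, by omega⟩⟩
  have : Nontrivial (Runge.Euc n) := inferInstance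
  have hn0 : (0 : ℝ) < n := by exact_mod_cast (by omega : 0 < n)
  choose q hq hqJ using fun k => Runge.exists_normalized_solidHarmonic (n := n) hn k
  -- The degree is the integer part of `j / n`, not `j`: this bounds `a` below by `1 / (3j)`
  -- uniformly in `n`, safely above the tolerance `1 / (10j)`. The price is a growth rate
  -- proportional to `1 / n`.
  refine ⟨Real.log 2 / n / 20, by positivity, fun j => q (j / n), fun j hj =>
    ⟨(hq _).mem_harmonicH1 Metric.isBounded_ball, (hq _).h1Norm_half_ball hn (hqJ _),
      fun u hu hclose g hg => ?_⟩⟩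
  set k := j / n
  have hj1 : (1 : ℝ) ≤ j := by exact_mod_cast hj
  set a := Real.sqrt ((1 + 4 * k * (n + 2 * k) : ℝ)⁻¹) with ha
  have ha2 : a ^ 2 = (1 + 4 * k * (n + 2 * k) : ℝ)⁻¹ := Real.sq_sqrt (by positivity)
  have hmain := (hq k).le_eLpNorm_trace (by omega) (Real.sqrt_pos.2 (by positivity))
    (by positivity) ((hqJ k).trans ha2.symm) hu.1 hclose hg
  -- From `k n ≤ j` and `2k ≤ k n`, one gets `1 + 4kn + 8k² ≤ 1 + 4j + 2j² ≤ 9j²`.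
  have ha3 : (3 * (j : ℝ))⁻¹ ≤ a := by
    refine Real.le_sqrt_of_sq_le ?_
    rw [inv_pow]
    have hk1 : (k : ℝ) * n ≤ j := by exact_mod_cast Nat.div_mul_le_self j n
    have hk2 : (k : ℝ) * 2 ≤ k * n := by
      have : (2 : ℝ) ≤ n := by exact_mod_cast hn
      exact mul_le_mul_of_nonneg_left this (Nat.cast_nonneg k)
    have hk0 : (0 : ℝ) ≤ k := Nat.cast_nonneg k
    refine inv_anti₀ (by positivity) ?_
    nlinarith
  have hlow : 2 ^ k / (5 * j) ≤ (eLpNorm g 2 (Runge.sphereMeasure n)).toReal := by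
    refine le_trans ?_ hmain
    rw [div_eq_mul_inv]
    refine mul_le_mul_of_nonneg_left ?_ (by positivity)
    have e : (5 * (j : ℝ))⁻¹ ≤ (3 * (j : ℝ))⁻¹ - (10 * (j : ℝ))⁻¹ := by
      rw [mul_inv, mul_inv, mul_inv]
      have : (0 : ℝ) < (j : ℝ)⁻¹ := by positivity
      linarith
    linarith
  refine le_trans ?_ (Runge.eLpNorm_le_hHalfNorm g)
  rw [ENNReal.ofReal_le_iff_le_toReal hg.1.eLpNorm_ne_top]
  refine le_trans ?_ hlow
  set t := Real.log 2 / n with ht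
  have htpos : 0 < t := by positivity
  -- Rounding down costs one power of `2`, since only `j ≤ n (k + 1)` is available.
  have hpow : Real.exp (j * t) ≤ 2 ^ (k + 1) := by
    have hjn : (j : ℝ) ≤ n * (k + 1) := by
      exact_mod_cast (Nat.lt_mul_div_succ j (by omega : 0 < n)).le
    calc Real.exp (j * t) ≤ Real.exp (((k + 1 : ℕ) : ℝ) * Real.log 2) := by
          refine Real.exp_le_exp.2 ?_
          rw [ht, mul_div_assoc', div_le_iff₀ hn0]
          push_cast
          calc (j : ℝ) * Real.log 2 ≤ (n * (k + 1)) * Real.log 2 :=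
                mul_le_mul_of_nonneg_right hjn (Real.log_nonneg (by norm_num))
            _ = (k + 1) * Real.log 2 * n := by ring
      _ = 2 ^ (k + 1) := by rw [Real.exp_nat_mul, Real.exp_log (by norm_num)]
  -- One half of the exponent absorbs the polynomial factor `5 * j`; the other dominates the claimed
  -- exponential.
  have hsplit : Real.exp (j * t) = Real.exp (j * t / 2) * Real.exp (j * t / 2) := by
    rw [← Real.exp_add]
    ring_nf
  have h1 : j * t / 2 ≤ Real.exp (j * t / 2) := by linarith [Real.add_one_le_exp (j * t / 2)]
  have h2 : Real.exp (t / 20 * j) ≤ Real.exp (j * t / 2) := Real.exp_le_exp.2 (by nlinarith)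
  rw [le_div_iff₀ (by positivity)]
  have h3 := Real.exp_pos (j * t / 2)
  have h4 : t / 20 * Real.exp (t / 20 * j) * (5 * j) ≤
      (j * t / 2) * Real.exp (j * t / 2) / 2 := by
    have := mul_le_mul_of_nonneg_left h2 (by positivity : 0 ≤ t / 20 * (5 * j))
    linarith
  have h5 := mul_le_mul_of_nonneg_right h1 h3.le
  rw [pow_succ] at hpow
  linarith
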